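/- **Setting.** Let $n\ge 1$ and let $(X_i,Y_i,T_i)_{1\le i\le n}$ be real random variables, of which only $X_i$, $T_i$ and $\delta_i=\mathbf 1_{\{Y_i\le T_i\}}$ are observed. Let $F(x,y)=P(Y\le y\mid X=x)$ be given by a regular conditional distribution $\kappa(x,\cdot)$ of $Y$ given $X=x$. The sampling scheme is one of the following: (a) the triples are i.i.d., $\kappa$ is the conditional law of $Y_i$ given $X_i$, and $(Y_i)_i$ is independent of $(T_i)_i$ conditionally on $(X_i)_i$; (b) the design $(\mathbf X,\mathbf T)=(X_i,T_i)_{i}$ has an arbitrary joint law and, given $(\mathbf X,\mathbf T)$, the $Y_i$ are independent with laws $\kappa(X_i,\cdot)$; (c) the design is deterministic, $(X_i,T_i)=(x_i,t_i)$, and the $Y_i$ are independent with laws $\kappa(x_i,\cdot)$. **Models.** Let $A_1,A_2$ be compact intervals. For $j=1,2$ and every $n$ let $\{S^{(j)}_{m_j},\, m_j\in I^{(j)}_n\}$ be a collection of linear subspaces of $L^2(A_j)$ of finite dimensions $D^{(j)}_{m_j}$, with orthonormal bases of Borel functions on $A_j$ (extended by $0$). For $m=(m_1,m_2)\in I_n=I_n^{(1)}\times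 I_n^{(2)}$ let $S_m=S^{(1)}_{m_1}\otimes S^{(2)}_{m_2}$ be the span of the products of basis functions, and let $D_m=D^{(1)}_{m_1}D^{(2)}_{m_2}$. Assume (H) for $j=1,2$ and every $b>0$ there is a constant $B_j(b)$ such that $\sum_{m_j\in I_n^{(j)}}\exp\big(-b\sqrt{D^{(j)}_{m_j}}\big)\le B_j(b)$ for all $n\ge 1$. **Estimator.** Put $\|s\|_n^2=\frac1n\sum_{i=1}^n s(X_i,T_i)^2$ and $\gamma_n(s)=\frac1n\sum_{i=1}^n(\delta_i-s(X_i,T_i))^2$. Let $\theta>1$ and $\mathrm{pen}(m)=\frac{\theta}{4}\frac{D_m}{n}$. Let $\hat F_m$ be a minimizer of $\gamma_n$ over $S_m$, let $\hat m$ be a minimizer of $\gamma_n(\hat F_m)+\mathrm{pen}(m)$ over $m\in I_n$, and let $\tilde F_m=\min(1,\max(0,\hat F_m))$. **Theorem.** There exist a constant $C_1>0$ depending only on $\theta$, and a constant $C_2>0$ depending only on $\theta$ and on the bounds $B_1(\cdot),B_2(\cdot)$ in (H), such that for every $n\ge1$, under (a) or (b), $$\mathbb E\big[\|\tilde F_{\hat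 m}-F\|_n^2\,\big|\,\mathbf X,\mathbf T\big]\le C_1\inf_{m\in I_n}\Big\{\inf_{t\in S_m}\|F-t\|_n^2+\mathrm{pen}(m)\Big\}+\frac{C_2}{n}\quad\text{a.s.},$$ and, under (c), the same inequality holds with the expectation $\mathbb E\big[\|\tilde F_{\hat m}-F\|_n^2\big]$ on the left-hand side. -/

import Mathlib

open MeasureTheory ProbabilityTheory Set

universe u v

noncomputable section

namespace CurrentStatus

/-- For every sample size `n`, a collection of finite-dimensional linear subspaces of
`L²([a,b])`, indexed by `ι n`. The model with index `m` has dimension `dim n m` and is given by an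
orthonormal basis `basis n m` made of Borel functions on `[a,b]`, extended by zero to `ℝ`. -/
structure ModelCollection (a b : ℝ) where
  ι : ℕ → Type u
  dim : (n : ℕ) → ι n → ℕ
  basis : (n : ℕ) → (m : ι n) → Fin (dim n m) → ℝ → ℝ
  measurable : ∀ n m k, Measurable (basis n m k)
  eq_zero_of_notMem : ∀ n m k, ∀ x ∉ Icc a b, basis n m k x = 0
  memLp : ∀ n m k, MemLp (basis n m k) 2 (volume.restrict (Icc a b))
  orthonormal : ∀ n m k l,
    ∫ x in Icc a b, basis n m k x * basis n m l x = if k = l then 1 else 0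

/-- Assumption (H) for one collection, with the bounds named: for every `c > 0`, the sum
`∑ exp (-c √D)` over the models of the collection is at most `B c`, whatever `n ≥ 1`. -/
def ModelCollection.HypH {a b : ℝ} (M : ModelCollection.{u} a b) (B : ℝ → ℝ) : Prop :=
  ∀ c : ℝ, 0 < c → ∀ n : ℕ, 1 ≤ n →
    ∑' m : M.ι n, ENNReal.ofReal (Real.exp (-c * √(M.dim n m : ℝ))) ≤ ENNReal.ofReal (B c)

section Models

variable {a₁ b₁ a₂ b₂ : ℝ} (M₁ : ModelCollection.{u} a₁ b₁) (M₂ : ModelCollection.{u} a₂ b₂)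

/-- The tensor product model `S_m = S_{m₁} ⊗ S_{m₂}`, a space of functions on `ℝ × ℝ` that vanish
outside `[a₁,b₁] × [a₂,b₂]`. -/
def tensorModel (n : ℕ) (m : M₁.ι n × M₂.ι n) : Submodule ℝ (ℝ × ℝ → ℝ) :=
  Submodule.span ℝ (range fun (kl : Fin (M₁.dim n m.1) × Fin (M₂.dim n m.2)) (p : ℝ × ℝ) =>
    M₁.basis n m.1 kl.1 p.1 * M₂.basis n m.2 kl.2 p.2)

/-- `pen(m) = (θ/4) D_m / n` with `D_m = D_{m₁} D_{m₂}`. -/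
def penalty (θ : ℝ) (n : ℕ) (m : M₁.ι n × M₂.ι n) : ℝ :=
  θ / 4 * ((M₁.dim n m.1 * M₂.dim n m.2 : ℕ) : ℝ) / n

end Models

/-- The squared empirical norm `‖s‖_n² = (1/n) ∑ s(X_i,T_i)²` for the design `d = (X_i,T_i)_i`. -/
def empSq {n : ℕ} (d : Fin n → ℝ × ℝ) (s : ℝ × ℝ → ℝ) : ℝ :=
  (1 / (n : ℝ)) * ∑ i, s (d i) ^ 2

/-- The least-squares contrast `γ_n(s) = (1/n) ∑ (δ_i - s(X_i,T_i))²`. -/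
def contrast {n : ℕ} (d : Fin n → ℝ × ℝ) (δ : Fin n → ℝ) (s : ℝ × ℝ → ℝ) : ℝ :=
  (1 / (n : ℝ)) * ∑ i, (δ i - s (d i)) ^ 2

/-- Truncation of a function to the interval `[0,1]`. -/
def trunc (s : ℝ × ℝ → ℝ) (p : ℝ × ℝ) : ℝ :=
  if s p < 0 then 0 else if 1 < s p then 1 else s p

/-- The current status indicator of `{y ≤ t}`. -/
def status (y t : ℝ) : ℝ := if y ≤ t then 1 else 0

/-- The conditional cumulative distribution function `F(x,y) = P[Y ≤ y | X = x]`, where `κ x` is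
the conditional law of `Y` given `X = x`. -/
def condCdf (κ : Kernel ℝ ℝ) (p : ℝ × ℝ) : ℝ := (κ p.1).real (Iic p.2)

section Estimator

variable {Ω : Type v} [MeasurableSpace Ω]
variable {a₁ b₁ a₂ b₂ : ℝ} (M₁ : ModelCollection.{u} a₁ b₁) (M₂ : ModelCollection.{u} a₂ b₂)

/-- `fit ω m` is a least-squares estimator `F̂_m` on the model `S_m` and `sel ω` is a selected model
`m̂`, which minimizes `γ_n(F̂_m) + pen(m)`; both are computed from the design `d ω` and the statuses
`δ ω`. Measurability is asked of `sel` and of the fitted values at the design points (the latter do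
not depend on the choice of the minimizers). -/
structure IsModelSelection (θ : ℝ) {n : ℕ} (d : Ω → Fin n → ℝ × ℝ) (δ : Ω → Fin n → ℝ)
    (fit : Ω → M₁.ι n × M₂.ι n → ℝ × ℝ → ℝ) (sel : Ω → M₁.ι n × M₂.ι n) : Prop where
  fit_mem : ∀ ω m, fit ω m ∈ tensorModel M₁ M₂ n m
  fit_min : ∀ ω m, ∀ s ∈ tensorModel M₁ M₂ n m,
    contrast (d ω) (δ ω) (fit ω m) ≤ contrast (d ω) (δ ω) s
  sel_min : ∀ ω m,
    contrast (d ω) (δ ω) (fit ω (sel ω)) + penalty M₁ M₂ θ n (sel ω)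
      ≤ contrast (d ω) (δ ω) (fit ω m) + penalty M₁ M₂ θ n m
  measurable_fit : ∀ m i, Measurable fun ω => fit ω m (d ω i)
  measurable_sel : ∀ m, MeasurableSet {ω | sel ω = m}

end Estimator

section Sampling

variable {Ω : Type v} [MeasurableSpace Ω]

/-- The i.i.d. current status model: the triples `(X_i, Y_i, T_i)` are i.i.d., `κ` is the
conditional law of `Y_i` given `X_i`, and `(Y_i)_i` is independent of `(T_i)_i` conditionally on
`(X_i)_i`. (When `Ω` is a standard Borel space, the last field is Mathlib's `CondIndepFun`.) -/
structure IsIIDSample (μ : Measure Ω) (κ : Kernel ℝ ℝ) {n : ℕ} (X Y T : Fin n → Ω → ℝ) :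
    Prop where
  measurable_X : ∀ i, Measurable (X i)
  measurable_Y : ∀ i, Measurable (Y i)
  measurable_T : ∀ i, Measurable (T i)
  indep : iIndepFun (fun i ω => (X i ω, Y i ω, T i ω)) μ
  ident : ∀ i j, IdentDistrib (fun ω => (X i ω, Y i ω, T i ω)) (fun ω => (X j ω, Y j ω, T j ω)) μ μ
  condLaw : ∀ i, HasCondDistrib (Y i) (X i) κ μ
  condIndep : ∀ s t : Set (Fin n → ℝ), MeasurableSet s → MeasurableSet t →
    (μ⟦(fun ω i => Y i ω) ⁻¹' s ∩ (fun ω i => T i ω) ⁻¹' t |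
        MeasurableSpace.comap (fun ω i => X i ω) inferInstance⟧)
      =ᵐ[μ] fun ω =>
        (μ⟦(fun ω i => Y i ω) ⁻¹' s | MeasurableSpace.comap (fun ω i => X i ω) inferInstance⟧) ω *
        (μ⟦(fun ω i => T i ω) ⁻¹' t | MeasurableSpace.comap (fun ω i => X i ω) inferInstance⟧) ω

/-- The current status model with a random design `(X_i, T_i)_i` of arbitrary joint law: given the
design, the lifetimes `Y_i` are independent and `Y_i` has law `κ (X_i)`. -/
structure IsSampleOfDesign (μ : Measure Ω) (κ : Kernel ℝ ℝ) {n : ℕ} (X Y T : Fin n → Ω → ℝ) :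
    Prop where
  measurable_X : ∀ i, Measurable (X i)
  measurable_Y : ∀ i, Measurable (Y i)
  measurable_T : ∀ i, Measurable (T i)
  condLaw : ∀ s : Fin n → Set ℝ, (∀ i, MeasurableSet (s i)) →
    (μ⟦⋂ i, Y i ⁻¹' s i | MeasurableSpace.comap (fun ω i => (X i ω, T i ω)) inferInstance⟧)
      =ᵐ[μ] fun ω => ∏ i, (κ (X i ω)).real (s i)

end Sampling

/-- The right-hand side of the oracle inequality for the design `d`:
`C₁ inf_m { inf_{s ∈ S_m} ‖F - s‖_n² + pen(m) } + C₂ / n`. -/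
def oracleBound {a₁ b₁ a₂ b₂ : ℝ} (M₁ : ModelCollection.{u} a₁ b₁) (M₂ : ModelCollection.{u} a₂ b₂)
    (κ : Kernel ℝ ℝ) (θ C₁ C₂ : ℝ) {n : ℕ} (d : Fin n → ℝ × ℝ) : ℝ :=
  C₁ * (⨅ m : M₁.ι n × M₂.ι n,
      ((⨅ s : tensorModel M₁ M₂ n m, empSq d (condCdf κ - (s : ℝ × ℝ → ℝ)))
        + penalty M₁ M₂ θ n m))
    + C₂ / n

end CurrentStatus

end

open CurrentStatus

/-! ### Exponential moments of Gaussian variables. -/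

section GaussianIntegrals

/-! Given the design, this is fixed-design regression in `EuclideanSpace ℝ (Fin n)`: the statuses
are the values of `F` plus a noise `ε` with independent centered coordinates, each in an interval of
length one. By Hoeffding's lemma `ε` is sub-Gaussian with proxy `1/4`, so its squared projection on
a `D`-dimensional space is of order `D/4`. This is why a penalty `θ D / (4n)` with `θ > 1` suffices.

Fix `1 < a < θ`. Comparing the selected fit with the projection of `F` on model `m` gives a
deterministic bound (`norm_sq_sub_le_of_penalized_min`): the loss is at most a constant times bias
plus penalty, plus a multiple of the excess of `a ‖Π ε‖²` over the penalties, where `Π` projects on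
`S_m + S_m̂`. Since `m̂` is random, the excess is replaced by its supremum over `m'`. Its
expectation is bounded by a sum of terms exponentially small in `D_{m'}`
(`lintegral_mul_norm_sq_starProjection_sub_le`), and (H) bounds this sum uniformly in `n`
(`lintegral_supExcess_le`).

The exponential moments of `‖Π ε‖²` come from Gaussian linearization: `exp (l ‖Π ε‖²)` is the
average of `exp ⟨w, ε⟩` over a Gaussian `w` in the subspace. Tonelli and the sub-Gaussian bound
reduce it to a chi-square integral.

On the probabilistic side, scheme (a) implies (b), scheme (c) is (b) with a constant design, and
under (b) the conditional expectation is an integral against the product kernel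
(`IsSampleOfDesign.condExp_ae_eq`). -/

theorem lintegral_exp_mul_gaussianReal (t : ℝ) :
    ∫⁻ x, ENNReal.ofReal (Real.exp (t * x)) ∂gaussianReal 0 1
      = ENNReal.ofReal (Real.exp (t ^ 2 / 2)) := by
  rw [← ofReal_integral_eq_lintegral_ofReal (integrable_exp_mul_gaussianReal t)
    (Filter.Eventually.of_forall fun _ => (Real.exp_pos _).le)]
  have h := congrFun (mgf_fun_id_gaussianReal (μ := 0) (v := 1)) t
  simp only [mgf] at h
  rw [h]
  simp

theorem integral_exp_mul_sq_gaussianReal {s : ℝ} (hs : s < 1 / 2) :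
    ∫ x, Real.exp (s * x ^ 2) ∂gaussianReal 0 1 = (√(1 - 2 * s))⁻¹ := by
  rw [integral_gaussianReal_eq_integral_smul one_ne_zero]
  have h : ∀ x : ℝ, gaussianPDFReal 0 1 x • Real.exp (s * x ^ 2)
      = (√(2 * Real.pi))⁻¹ * Real.exp (-(1 / 2 - s) * x ^ 2) := by
    intro x
    rw [gaussianPDFReal_def, smul_eq_mul, mul_assoc, ← Real.exp_add]
    simp only [NNReal.coe_one, mul_one]
    congr 2
    ring
  simp_rw [h]
  rw [integral_const_mul, integral_gaussian, ← Real.sqrt_inv, ← Real.sqrt_inv,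
    ← Real.sqrt_mul (by positivity)]
  congr 1
  have h1 : 1 / 2 - s ≠ 0 := by linarith
  have h2 : 1 - 2 * s ≠ 0 := by linarith
  have := Real.pi_ne_zero
  field_simp

theorem lintegral_exp_mul_sq_gaussianReal {s : ℝ} (hs : s < 1 / 2) :
    ∫⁻ x, ENNReal.ofReal (Real.exp (s * x ^ 2)) ∂gaussianReal 0 1
      = ENNReal.ofReal (√(1 - 2 * s))⁻¹ := by
  rw [← integral_exp_mul_sq_gaussianReal hs, ofReal_integral_eq_lintegral_ofReal]
  · refine Integrable.of_integral_ne_zero ?_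
    rw [integral_exp_mul_sq_gaussianReal hs]
    have : 0 < 1 - 2 * s := by linarith
    positivity
  · exact Filter.Eventually.of_forall fun _ => (Real.exp_pos _).le

/-- Tonelli's theorem for the exponential of a sum of functions of distinct coordinates. -/
theorem lintegral_pi_exp_sum {ι : Type*} [Fintype ι] {α : ι → Type*} [∀ i, MeasurableSpace (α i)]
    (ν : ∀ i, Measure (α i)) [∀ i, IsProbabilityMeasure (ν i)] (f : ∀ i, α i → ℝ)
    (hf : ∀ i, Measurable (f i)) :
    ∫⁻ x, ENNReal.ofReal (Real.exp (∑ i, f i (x i))) ∂Measure.pi ν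
      = ∏ i, ∫⁻ y, ENNReal.ofReal (Real.exp (f i y)) ∂ν i := by
  have hm : ∀ i, Measurable fun y => ENNReal.ofReal (Real.exp (f i y)) := fun i =>
    (hf i).exp.ennreal_ofReal
  simp_rw [Real.exp_sum, ENNReal.ofReal_prod_of_nonneg fun i _ => (Real.exp_pos _).le]
  rw [lintegral_prod_eq_prod_lintegral_of_indepFun Finset.univ
    (fun i (x : ∀ i, α i) => ENNReal.ofReal (Real.exp (f i (x i))))
    (iIndepFun_pi fun i => (hm i).aemeasurable) fun i => (hm i).comp (measurable_pi_apply i)]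
  exact Finset.prod_congr rfl fun i _ => (measurePreserving_eval ν i).lintegral_comp (hm i)

end GaussianIntegrals

/-! ### Projections of sub-Gaussian vectors. -/

section SubGaussianVector

variable {E : Type*} [NormedAddCommGroup E] [InnerProductSpace ℝ E] [FiniteDimensional ℝ E]

theorem norm_sq_starProjection_eq_sum (W : Submodule ℝ E) (x : E) :
    ‖W.starProjection x‖ ^ 2
      = ∑ k, (inner ℝ ((stdOrthonormalBasis ℝ W k : W) : E) x) ^ 2 := by
  have h := (stdOrthonormalBasis ℝ W).sum_sq_norm_inner_right (W.orthogonalProjectionOnto x)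
  rw [Submodule.starProjection_apply, ← Submodule.coe_norm, ← h]
  refine Finset.sum_congr rfl fun k _ => ?_
  rw [Real.norm_eq_abs, sq_abs, Submodule.inner_orthogonalProjectionOnto_eq_of_mem_left]

variable [MeasurableSpace E] [BorelSpace E]

/-- The squared projection of a sub-Gaussian vector with variance proxy `1/4` has, at most, the
exponential moments of a quarter of a chi-square variable. -/
theorem lintegral_exp_mul_norm_sq_starProjection_le {Ω : Type*} [MeasurableSpace Ω] (P : Measure Ω)
    [SFinite P] (ε : Ω → E) (hε : Measurable ε)
    (h : ∀ w : E, ∫⁻ ω, ENNReal.ofReal (Real.exp (inner ℝ w (ε ω))) ∂P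
      ≤ ENNReal.ofReal (Real.exp (‖w‖ ^ 2 / 8)))
    (W : Submodule ℝ E) {l : ℝ} (hl0 : 0 ≤ l) (hl : l < 2) :
    ∫⁻ ω, ENNReal.ofReal (Real.exp (l * ‖W.starProjection (ε ω)‖ ^ 2)) ∂P
      ≤ ENNReal.ofReal (√(1 - l / 2))⁻¹ ^ Module.finrank ℝ W := by
  set u := stdOrthonormalBasis ℝ W
  set γ : Measure (Fin (Module.finrank ℝ W) → ℝ) := Measure.pi fun _ => gaussianReal 0 1
  have hinner : ∀ ω (g : Fin (Module.finrank ℝ W) → ℝ),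
      ∑ k, √(2 * l) * inner ℝ ((u k : W) : E) (ε ω) * g k
        = inner ℝ (√(2 * l) • ∑ k, g k • ((u k : W) : E)) (ε ω) := by
    intro ω g
    rw [inner_smul_left, sum_inner, Finset.mul_sum]
    refine Finset.sum_congr rfl fun k _ => ?_
    rw [inner_smul_left]
    simp only [conj_trivial]
    ring
  have hnorm : ∀ g : Fin (Module.finrank ℝ W) → ℝ,
      ‖√(2 * l) • ∑ k, g k • ((u k : W) : E)‖ ^ 2 / 8 = ∑ k, l / 4 * (g k) ^ 2 := by
    intro g
    have h1 : ∑ k, g k • ((u k : W) : E) = ((∑ k, g k • u k : W) : E) := by simp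
    have h2 : ‖∑ k, g k • u k‖ ^ 2 = ∑ k, (g k) ^ 2 := by
      rw [← real_inner_self_eq_norm_sq, u.orthonormal.inner_sum]
      simp [sq]
    rw [norm_smul, mul_pow, h1, ← Submodule.coe_norm, h2, Real.norm_eq_abs, sq_abs,
      Real.sq_sqrt (by positivity), ← Finset.mul_sum]
    ring
  -- Linearize the square with an independent standard Gaussian `g`: `exp (l x²)` is the mean of
  -- `exp (√(2l) x g)`. After the swap, only the linear exponential moments of `ε` are needed.
  calc ∫⁻ ω, ENNReal.ofReal (Real.exp (l * ‖W.starProjection (ε ω)‖ ^ 2)) ∂P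
      = ∫⁻ ω, ∫⁻ g, ENNReal.ofReal
          (Real.exp (inner ℝ (√(2 * l) • ∑ k, g k • ((u k : W) : E)) (ε ω))) ∂γ ∂P := by
        refine lintegral_congr fun ω => ?_
        simp_rw [← hinner]
        rw [lintegral_pi_exp_sum (fun _ => gaussianReal 0 1)
          (fun k y => √(2 * l) * inner ℝ ((u k : W) : E) (ε ω) * y) fun k => by fun_prop]
        simp_rw [lintegral_exp_mul_gaussianReal]
        rw [← ENNReal.ofReal_prod_of_nonneg fun k _ => (Real.exp_pos _).le, ← Real.exp_sum,
          norm_sq_starProjection_eq_sum, Finset.mul_sum]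
        congr 2
        refine Finset.sum_congr rfl fun k _ => ?_
        rw [mul_pow, Real.sq_sqrt (by positivity)]
        ring
    _ = ∫⁻ g, ∫⁻ ω, ENNReal.ofReal
          (Real.exp (inner ℝ (√(2 * l) • ∑ k, g k • ((u k : W) : E)) (ε ω))) ∂P ∂γ := by
        refine lintegral_lintegral_swap (Measurable.aemeasurable ?_)
        refine (Real.measurable_exp.comp (Measurable.inner ?_ ?_)).ennreal_ofReal
        · have : Continuous fun g : Fin (Module.finrank ℝ W) → ℝ =>
            √(2 * l) • ∑ k, g k • ((u k : W) : E) := by fun_prop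
          exact this.measurable.comp measurable_snd
        · exact hε.comp measurable_fst
    _ ≤ ∫⁻ g, ENNReal.ofReal (Real.exp (∑ k, l / 4 * (g k) ^ 2)) ∂γ := by
        refine lintegral_mono fun g => (h _).trans_eq ?_
        rw [hnorm]
    _ = ENNReal.ofReal (√(1 - l / 2))⁻¹ ^ Module.finrank ℝ W := by
        rw [lintegral_pi_exp_sum (fun _ => gaussianReal 0 1) (fun k y => l / 4 * y ^ 2)
          fun k => by fun_prop]
        simp_rw [lintegral_exp_mul_sq_gaussianReal (show l / 4 < 1 / 2 by linarith)]
        rw [Finset.prod_const, Finset.card_univ, Fintype.card_fin]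
        congr 4
        ring

theorem inv_sqrt_one_sub_le_exp {x : ℝ} (hx : x < 1) :
    (√(1 - x))⁻¹ ≤ Real.exp (x / (1 - x) / 2) := by
  have h1 : 0 < 1 - x := by linarith
  rw [Real.exp_half, ← Real.sqrt_inv]
  refine Real.sqrt_le_sqrt ?_
  have h2 := Real.add_one_le_exp (x / (1 - x))
  have h3 : x / (1 - x) + 1 = (1 - x)⁻¹ := by field_simp; ring
  linarith

/-- The excess of the squared projection of a sub-Gaussian vector over a penalty larger than
its expectation by a constant factor is exponentially small in the dimension. -/
theorem lintegral_mul_norm_sq_starProjection_sub_le {Ω : Type*} [MeasurableSpace Ω] (P : Measure Ω)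
    [SFinite P] (ε : Ω → E) (hε : Measurable ε)
    (h : ∀ w : E, ∫⁻ ω, ENNReal.ofReal (Real.exp (inner ℝ w (ε ω))) ∂P
      ≤ ENNReal.ofReal (Real.exp (‖w‖ ^ 2 / 8)))
    (W : Submodule ℝ E) {K : ℕ} (hK : Module.finrank ℝ W ≤ K) {a θ : ℝ} (ha : 0 < a) (haθ : a < θ) :
    ∫⁻ ω, ENNReal.ofReal (a * ‖W.starProjection (ε ω)‖ ^ 2 - θ * K / 4) ∂P
      ≤ ENNReal.ofReal
        (a * θ / (θ - a) * Real.exp (-((θ - a) ^ 2 / (4 * a * (θ + a))) * K)) := by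
  -- Chernoff parameter. Per dimension the log of the bound is at most `l a / (4 (1 - l a / 2)) - l
  -- θ / 4`, which is negative for `0 < l < 2 (θ - a) / (a θ)`; `l` is the midpoint of this range.
  set l := (θ - a) / (a * θ) with hl
  have hθ : 0 < θ := ha.trans haθ
  have hd : 0 < θ - a := by linarith
  have hl0 : 0 < l := by positivity
  have hx : l * a / 2 = (θ - a) / (2 * θ) := by rw [hl]; field_simp
  have hx1 : l * a / 2 < 1 := by
    rw [hx, div_lt_one (by positivity)]; linarith
  have hxpos : 0 < l * a / 2 := by positivity
  set q := (√(1 - l * a / 2))⁻¹ with hq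
  have hq1 : 1 ≤ q := by
    rw [hq, one_le_inv₀ (Real.sqrt_pos.2 (by linarith))]
    exact Real.sqrt_le_one.2 (by linarith)
  have hqe : q * Real.exp (-(l * θ / 4)) ≤ Real.exp (-((θ - a) ^ 2 / (4 * a * (θ + a)))) := by
    refine (mul_le_mul_of_nonneg_right (inv_sqrt_one_sub_le_exp hx1) (Real.exp_pos _).le).trans ?_
    rw [← Real.exp_add, hx]
    refine Real.exp_le_exp.2 (le_of_eq ?_)
    have h1 : 1 - (θ - a) / (2 * θ) = (θ + a) / (2 * θ) := by field_simp; ring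
    rw [h1, hl]
    have : θ + a ≠ 0 := by positivity
    field_simp
    ring
  -- Bounding the excess by an exponential controls its expectation without integrating tail
  -- probabilities.
  have hpt : ∀ x : ℝ, x ≤ 1 / l * Real.exp (l * x) := by
    intro x
    have := Real.add_one_le_exp (l * x)
    rw [one_div, ← div_eq_inv_mul, le_div_iff₀ hl0]
    nlinarith
  calc ∫⁻ ω, ENNReal.ofReal (a * ‖W.starProjection (ε ω)‖ ^ 2 - θ * K / 4) ∂P
      ≤ ∫⁻ ω, ENNReal.ofReal (1 / l * Real.exp (-(l * θ / 4)) ^ K) *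
          ENNReal.ofReal (Real.exp (l * a * ‖W.starProjection (ε ω)‖ ^ 2)) ∂P := by
        refine lintegral_mono fun ω => ?_
        rw [← ENNReal.ofReal_mul (by positivity)]
        refine ENNReal.ofReal_le_ofReal ((hpt _).trans_eq ?_)
        rw [← Real.exp_nat_mul, mul_assoc, ← Real.exp_add]
        congr 2
        ring
    _ = ENNReal.ofReal (1 / l * Real.exp (-(l * θ / 4)) ^ K) *
          ∫⁻ ω, ENNReal.ofReal (Real.exp (l * a * ‖W.starProjection (ε ω)‖ ^ 2)) ∂P :=
        lintegral_const_mul' _ _ ENNReal.ofReal_ne_top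
    _ ≤ ENNReal.ofReal (1 / l * Real.exp (-(l * θ / 4)) ^ K) * ENNReal.ofReal (q ^ K) := by
        gcongr
        refine (lintegral_exp_mul_norm_sq_starProjection_le P ε hε h W (by positivity)
          (by linarith)).trans ?_
        rw [← ENNReal.ofReal_pow (by positivity)]
        exact ENNReal.ofReal_le_ofReal (pow_le_pow_right₀ hq1 hK)
    _ ≤ _ := by
        rw [← ENNReal.ofReal_mul (by positivity)]
        refine ENNReal.ofReal_le_ofReal ?_
        rw [mul_assoc, ← mul_pow, mul_comm _ q, mul_comm _ (K : ℝ), Real.exp_nat_mul]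
        have : a * θ / (θ - a) = 1 / l := by rw [hl, one_div_div]
        rw [this]
        gcongr

end SubGaussianVector

/-! ### Projections and the penalized least-squares comparison. -/

section Projection

variable {E : Type*} [NormedAddCommGroup E] [InnerProductSpace ℝ E] [FiniteDimensional ℝ E]

/-- Expand `0 ≤ ‖Π x - w‖²`. With equality at `w = Π x`, this is the variational formula for `‖Π
x‖²`; it serves the noise bound, the bias bound and measurability. -/
theorem two_mul_inner_sub_norm_sq_le (W : Submodule ℝ E) (x : E) {w : E} (hw : w ∈ W) :
    2 * inner ℝ x w - ‖w‖ ^ 2 ≤ ‖W.starProjection x‖ ^ 2 := by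
  have h1 : inner ℝ x w = inner ℝ (W.starProjection x) w := by
    rw [Submodule.inner_starProjection_left_eq_right, Submodule.starProjection_eq_self_iff.2 hw]
  have h2 := norm_sub_sq_real (W.starProjection x) w
  have h3 := sq_nonneg ‖W.starProjection x - w‖
  rw [h1]
  linarith

theorem two_mul_inner_starProjection_sub_norm_sq (W : Submodule ℝ E) (x : E) :
    2 * inner ℝ x (W.starProjection x) - ‖W.starProjection x‖ ^ 2
      = ‖W.starProjection x‖ ^ 2 := by
  have h1 : inner ℝ x (W.starProjection x)
      = inner ℝ (W.starProjection x) (W.starProjection x) := by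
    conv_rhs => rw [Submodule.inner_starProjection_left_eq_right,
      Submodule.starProjection_eq_self_iff.2 (W.starProjection_apply_mem x)]
  rw [h1, real_inner_self_eq_norm_sq]
  ring

/-- A countable supremum of continuous functions of `b` and `x` is measurable in both, even where
the dimension of the span jumps with the design. -/
theorem norm_sq_starProjection_span_eq_iSup {ι : Type*} [Fintype ι] (b : ι → E) (x : E) :
    ‖(Submodule.span ℝ (range b)).starProjection x‖ ^ 2
      = ⨆ c : ι → ℚ, (2 * inner ℝ x (∑ k, (c k : ℝ) • b k) - ‖∑ k, (c k : ℝ) • b k‖ ^ 2) := by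
  set W := Submodule.span ℝ (range b)
  have hmem : ∀ c : ι → ℝ, ∑ k, c k • b k ∈ W := fun c =>
    Submodule.sum_mem _ fun k _ => Submodule.smul_mem _ _ (Submodule.subset_span ⟨k, rfl⟩)
  refine le_antisymm ?_ (ciSup_le fun c => two_mul_inner_sub_norm_sq_le W x (hmem _))
  have hbdd : BddAbove (range fun c : ι → ℚ =>
      (2 * inner ℝ x (∑ k, (c k : ℝ) • b k) - ‖∑ k, (c k : ℝ) • b k‖ ^ 2)) :=
    ⟨_, by rintro _ ⟨c, rfl⟩; exact two_mul_inner_sub_norm_sq_le W x (hmem _)⟩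
  have hdense : DenseRange fun (c : ι → ℚ) (k : ι) => (c k : ℝ) :=
    DenseRange.piMap fun _ => Rat.denseRange_cast
  have key : ∀ c : ι → ℝ, 2 * inner ℝ x (∑ k, c k • b k) - ‖∑ k, c k • b k‖ ^ 2
      ≤ ⨆ c : ι → ℚ, (2 * inner ℝ x (∑ k, (c k : ℝ) • b k) - ‖∑ k, (c k : ℝ) • b k‖ ^ 2) :=
    fun c => hdense.induction_on c (isClosed_le (by fun_prop) continuous_const)
      fun q => le_ciSup hbdd q
  obtain ⟨c, hc⟩ := (Submodule.mem_span_range_iff_exists_fun ℝ).1 (W.starProjection_apply_mem x)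
  rw [← two_mul_inner_starProjection_sub_norm_sq, ← hc]
  exact key c

theorem measurable_norm_sq_starProjection_span [MeasurableSpace E] [BorelSpace E] {Ω : Type*}
    [MeasurableSpace Ω] {ι : Type*} [Fintype ι] {b : Ω → ι → E} (hb : ∀ k, Measurable fun ω => b ω k)
    {x : Ω → E} (hx : Measurable x) :
    Measurable fun ω => ‖(Submodule.span ℝ (range (b ω))).starProjection (x ω)‖ ^ 2 := by
  simp_rw [norm_sq_starProjection_span_eq_iSup]
  refine Measurable.iSup fun c => ?_
  have : Measurable fun ω => ∑ k, (c k : ℝ) • b ω k :=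
    Finset.measurable_sum _ fun k _ => (hb k).const_smul _
  exact ((hx.inner this).const_mul 2).sub (this.norm.pow_const 2)

/-- The deterministic comparison behind penalized least squares: `f` is the unknown vector, `ε` the
noise, `h` the selected fit with penalty `p'`, and `s` a competitor with penalty `p`. -/
theorem norm_sq_sub_le_of_penalized_min (W : Submodule ℝ E) {f ε h s : E} (hs : s ∈ W) (hh : h ∈ W)
    {a p p' : ℝ} (ha : 1 < a) (hp : 0 ≤ p)
    (hmin : ‖f + ε - h‖ ^ 2 + p' ≤ ‖f + ε - s‖ ^ 2 + p) :
    ‖f - h‖ ^ 2 ≤ 2 * a / (a - 1) * (2 + (a + 1) / (a * (a - 1))) * (‖f - s‖ ^ 2 + p)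
      + 2 * a / (a - 1) * max 0 (a * ‖W.starProjection ε‖ ^ 2 - (p + p')) := by
  have ha0 : 0 < a - 1 := by linarith
  have ha1 : 0 < a := by linarith
  have e1 := norm_add_sq_real (f - h) ε
  have e2 := norm_add_sq_real (f - s) ε
  rw [show f - h + ε = f + ε - h by abel] at e1
  rw [show f - s + ε = f + ε - s by abel] at e2
  have e3 : inner ℝ (f - s) ε - inner ℝ (f - h) ε = inner ℝ ε (h - s) := by
    rw [← inner_sub_left, real_inner_comm, sub_sub_sub_cancel_left]
  -- The variational inequality at `w = a⁻¹ (h - s)`, multiplied by `a`.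
  have e4 : 2 * inner ℝ ε (h - s) ≤ ‖h - s‖ ^ 2 / a + a * ‖W.starProjection ε‖ ^ 2 := by
    have := two_mul_inner_sub_norm_sq_le W ε (W.smul_mem a⁻¹ (W.sub_mem hh hs))
    rw [inner_smul_right, norm_smul, mul_pow, Real.norm_eq_abs, sq_abs] at this
    have h2 := mul_le_mul_of_nonneg_left this ha1.le
    have h3 : a * (2 * (a⁻¹ * inner ℝ ε (h - s)) - a⁻¹ ^ 2 * ‖h - s‖ ^ 2)
        = 2 * inner ℝ ε (h - s) - ‖h - s‖ ^ 2 / a := by field_simp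
    linarith
  -- Young's inequality with weight `(a - 1) / 2`: after division by `a`, the coefficient of `‖f -
  -- h‖²` is `(a + 1) / (2a) < 1`, so the term can be absorbed on the left.
  have e5 : ‖h - s‖ ^ 2 ≤ (a + 1) / 2 * ‖f - h‖ ^ 2 + (a + 1) / (a - 1) * ‖f - s‖ ^ 2 := by
    have h1 : ‖h - s‖ ≤ ‖f - h‖ + ‖f - s‖ := by
      calc ‖h - s‖ = ‖(f - s) - (f - h)‖ := by congr 1; abel
        _ ≤ ‖f - s‖ + ‖f - h‖ := norm_sub_le _ _
        _ = _ := add_comm _ _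
    have h2 : ‖h - s‖ ^ 2 ≤ (‖f - h‖ + ‖f - s‖) ^ 2 := by gcongr
    have h3 : (a + 1) / 2 * ‖f - h‖ ^ 2 + (a + 1) / (a - 1) * ‖f - s‖ ^ 2
        - (‖f - h‖ + ‖f - s‖) ^ 2
        = ((a - 1) * ‖f - h‖ - 2 * ‖f - s‖) ^ 2 / (2 * (a - 1)) := by field_simp; ring
    have h4 : 0 ≤ ((a - 1) * ‖f - h‖ - 2 * ‖f - s‖) ^ 2 / (2 * (a - 1)) := by positivity
    linarith
  have e6 := le_max_right 0 (a * ‖W.starProjection ε‖ ^ 2 - (p + p'))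
  set Z := max 0 (a * ‖W.starProjection ε‖ ^ 2 - (p + p'))
  have e7 : ‖h - s‖ ^ 2 / a ≤
      (a + 1) / (2 * a) * ‖f - h‖ ^ 2 + (a + 1) / (a * (a - 1)) * ‖f - s‖ ^ 2 := by
    rw [div_le_iff₀ ha1]
    refine e5.trans_eq ?_
    field_simp
  -- The noise term is at most `Z + p + p'`; `p'` cancels against the penalty of `h`, and `p` now
  -- occurs twice, whence the constant `2`.
  have e8 : (a - 1) / (2 * a) * ‖f - h‖ ^ 2
      ≤ (2 + (a + 1) / (a * (a - 1))) * (‖f - s‖ ^ 2 + p) + Z := by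
    have h1 : (a - 1) / (2 * a) = 1 - (a + 1) / (2 * a) := by field_simp; ring
    have h2 : 0 ≤ (a + 1) / (a * (a - 1)) * p := by positivity
    rw [h1]
    nlinarith [sq_nonneg ‖f - s‖]
  have h9 : ‖f - h‖ ^ 2 = 2 * a / (a - 1) * ((a - 1) / (2 * a) * ‖f - h‖ ^ 2) := by
    field_simp
  rw [h9, mul_assoc, ← mul_add]
  gcongr

end Projection

/-! ### Sub-Gaussianity of bounded independent noise. -/

section Hoeffding

/-- A vector of independent centered variables, each ranging in an interval of length one, is
sub-Gaussian with variance proxy `1/4`. -/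
theorem lintegral_exp_inner_le_of_mem_Icc {n : ℕ} (ν : Fin n → Measure ℝ)
    [∀ i, IsProbabilityMeasure (ν i)] (e : Fin n → ℝ → ℝ) (he : ∀ i, Measurable (e i))
    (l : Fin n → ℝ) (hmem : ∀ i y, e i y ∈ Icc (l i) (l i + 1)) (hint : ∀ i, ∫ y, e i y ∂ν i = 0)
    (w : EuclideanSpace ℝ (Fin n)) :
    ∫⁻ y, ENNReal.ofReal (Real.exp (inner ℝ w (WithLp.toLp 2 fun i => e i (y i))))
        ∂Measure.pi ν
      ≤ ENNReal.ofReal (Real.exp (‖w‖ ^ 2 / 8)) := by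
  have h1 : ∀ y : Fin n → ℝ, inner ℝ w (WithLp.toLp 2 fun i => e i (y i))
      = ∑ i, w i * e i (y i) := by
    intro y
    simp [PiLp.inner_apply, mul_comm]
  simp_rw [h1]
  rw [lintegral_pi_exp_sum ν (fun i z => w i * e i z) fun i => (he i).const_mul _,
    EuclideanSpace.real_norm_sq_eq, Finset.sum_div, Real.exp_sum,
    ENNReal.ofReal_prod_of_nonneg fun i _ => (Real.exp_pos _).le]
  refine Finset.prod_le_prod' fun i _ => ?_
  -- Hoeffding's lemma: length one gives proxy `(1/2)² = 1/4`, hence `exp (t² / 8)`.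
  have hsub := hasSubgaussianMGF_of_mem_Icc_of_integral_eq_zero (μ := ν i) (he i).aemeasurable
    (Filter.Eventually.of_forall (hmem i)) (hint i)
  rw [← ofReal_integral_eq_lintegral_ofReal (hsub.integrable_exp_mul (w i))
    (Filter.Eventually.of_forall fun _ => (Real.exp_pos _).le)]
  refine ENNReal.ofReal_le_ofReal ((hsub.mgf_le (w i)).trans_eq ?_)
  congr 1
  simp
  ring

end Hoeffding

namespace CurrentStatus

/-! ### The regression problem in Euclidean space. -/

section Design

variable {n : ℕ}

/-- The vector of the values of a function at the design points. -/
noncomputable def designVec (d : Fin n → ℝ × ℝ) : (ℝ × ℝ → ℝ) →ₗ[ℝ] EuclideanSpace ℝ (Fin n) where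
  toFun s := WithLp.toLp 2 fun i => s (d i)
  map_add' _ _ := rfl
  map_smul' _ _ := rfl

@[simp]
theorem designVec_apply (d : Fin n → ℝ × ℝ) (s : ℝ × ℝ → ℝ) (i : Fin n) :
    designVec d s i = s (d i) := rfl

theorem empSq_eq_norm_sq (d : Fin n → ℝ × ℝ) (s : ℝ × ℝ → ℝ) :
    empSq d s = 1 / (n : ℝ) * ‖designVec d s‖ ^ 2 := by
  simp [empSq, EuclideanSpace.real_norm_sq_eq]

/-- The vector of the centered statuses `𝟙 (y_i ≤ t_i) - F (x_i, t_i)`. -/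
noncomputable def noise (κ : Kernel ℝ ℝ) (d : Fin n → ℝ × ℝ) (y : Fin n → ℝ) :
    EuclideanSpace ℝ (Fin n) :=
  WithLp.toLp 2 fun i => status (y i) (d i).2 - condCdf κ (d i)

theorem contrast_status_eq (κ : Kernel ℝ ℝ) (d : Fin n → ℝ × ℝ) (y : Fin n → ℝ) (s : ℝ × ℝ → ℝ) :
    contrast d (fun i => status (y i) (d i).2) s
      = 1 / (n : ℝ) * ‖designVec d (condCdf κ) + noise κ d y - designVec d s‖ ^ 2 := by
  simp [contrast, EuclideanSpace.real_norm_sq_eq, noise]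

theorem condCdf_nonneg (κ : Kernel ℝ ℝ) (p : ℝ × ℝ) : 0 ≤ condCdf κ p := measureReal_nonneg

theorem condCdf_le_one (κ : Kernel ℝ ℝ) [IsMarkovKernel κ] (p : ℝ × ℝ) : condCdf κ p ≤ 1 :=
  measureReal_le_one

theorem measurable_condCdf (κ : Kernel ℝ ℝ) [IsMarkovKernel κ] : Measurable (condCdf κ) := by
  have hs : MeasurableSet {q : (ℝ × ℝ) × ℝ | q.2 ≤ q.1.2} :=
    measurableSet_le measurable_snd (measurable_snd.comp measurable_fst)
  exact (Kernel.measurable_kernel_prodMk_left (κ := κ.comap Prod.fst measurable_fst) hs).ennreal_toReal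

theorem measurable_status {Ω : Type*} [MeasurableSpace Ω] {Y T : Ω → ℝ} (hY : Measurable Y)
    (hT : Measurable T) : Measurable fun ω => status (Y ω) (T ω) :=
  Measurable.ite (measurableSet_le hY hT) measurable_const measurable_const

theorem measurable_designVec {s : ℝ × ℝ → ℝ} (hs : Measurable s) :
    Measurable fun d : Fin n → ℝ × ℝ => designVec d s :=
  (WithLp.measurable_toLp 2 (Fin n → ℝ)).comp
    (measurable_pi_lambda _ fun i => hs.comp (measurable_pi_apply i))

theorem measurable_noise (κ : Kernel ℝ ℝ) [IsMarkovKernel κ] :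
    Measurable fun q : (Fin n → ℝ × ℝ) × (Fin n → ℝ) => noise κ q.1 q.2 := by
  refine (WithLp.measurable_toLp 2 (Fin n → ℝ)).comp (measurable_pi_lambda _ fun i => ?_)
  refine (measurable_status (by fun_prop) (by fun_prop)).sub ((measurable_condCdf κ).comp ?_)
  fun_prop

theorem noise_coord_mem_Icc (κ : Kernel ℝ ℝ) (p : ℝ × ℝ) (y : ℝ) :
    status y p.2 - condCdf κ p ∈ Icc (-condCdf κ p) (-condCdf κ p + 1) := by
  unfold status
  constructor <;> split_ifs <;> linarith

theorem norm_sq_noise_le (κ : Kernel ℝ ℝ) [IsMarkovKernel κ] (d : Fin n → ℝ × ℝ)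
    (y : Fin n → ℝ) : ‖noise κ d y‖ ^ 2 ≤ n := by
  rw [EuclideanSpace.real_norm_sq_eq]
  calc ∑ i, (noise κ d y i) ^ 2 ≤ ∑ _i : Fin n, (1 : ℝ) := by
        refine Finset.sum_le_sum fun i _ => ?_
        have h : noise κ d y i ∈ _ := noise_coord_mem_Icc κ (d i) (y i)
        have h0 := condCdf_nonneg κ (d i)
        have h1 := condCdf_le_one κ (d i)
        exact (sq_le_one_iff_abs_le_one _).2 (abs_le.2 ⟨by linarith [h.1], by linarith [h.2]⟩)
    _ = n := by simp

theorem integral_status_sub_condCdf (κ : Kernel ℝ ℝ) [IsMarkovKernel κ] (p : ℝ × ℝ) :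
    ∫ y, (status y p.2 - condCdf κ p) ∂κ p.1 = 0 := by
  have h : (fun y => status y p.2) = (Iic p.2).indicator 1 := by
    ext y
    simp [status, indicator_apply]
  rw [integral_sub, h, integral_indicator_one measurableSet_Iic]
  · simp [condCdf]
  · rw [h]
    exact (integrable_const 1).indicator measurableSet_Iic
  · exact integrable_const _

theorem lintegral_exp_inner_noise_le (κ : Kernel ℝ ℝ) [IsMarkovKernel κ] (d : Fin n → ℝ × ℝ)
    (w : EuclideanSpace ℝ (Fin n)) :
    ∫⁻ y, ENNReal.ofReal (Real.exp (inner ℝ w (noise κ d y))) ∂Measure.pi (fun i => κ (d i).1)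
      ≤ ENNReal.ofReal (Real.exp (‖w‖ ^ 2 / 8)) :=
  lintegral_exp_inner_le_of_mem_Icc (fun i => κ (d i).1)
    (fun i y => status y (d i).2 - condCdf κ (d i))
    (fun _ => (measurable_status measurable_id measurable_const).sub_const _)
    (fun i => -condCdf κ (d i)) (fun i y => noise_coord_mem_Icc κ (d i) y)
    (fun i => integral_status_sub_condCdf κ (d i)) w

/-- Truncation is the projection onto `[0,1]`, which contains the values of `F`. It can only reduce
the loss, and it makes the loss bounded, hence integrable. -/
theorem abs_trunc_sub_le {s : ℝ × ℝ → ℝ} {p : ℝ × ℝ} {c : ℝ} (h0 : 0 ≤ c) (h1 : c ≤ 1) :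
    |trunc s p - c| ≤ |c - s p| := by
  unfold trunc
  split_ifs <;> rw [abs_le] <;> constructor <;> cases abs_cases (c - s p) <;> linarith

theorem trunc_mem_Icc (s : ℝ × ℝ → ℝ) (p : ℝ × ℝ) : trunc s p ∈ Icc 0 1 := by
  unfold trunc
  split_ifs with h1 h2 <;> simp only [mem_Icc] <;> constructor <;> linarith

theorem empSq_trunc_sub_le (κ : Kernel ℝ ℝ) [IsMarkovKernel κ] (d : Fin n → ℝ × ℝ)
    (s : ℝ × ℝ → ℝ) :
    empSq d (trunc s - condCdf κ)
      ≤ 1 / (n : ℝ) * ‖designVec d (condCdf κ) - designVec d s‖ ^ 2 := by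
  rw [EuclideanSpace.real_norm_sq_eq, empSq]
  refine mul_le_mul_of_nonneg_left (Finset.sum_le_sum fun i _ => ?_) (by positivity)
  exact sq_le_sq.2 (abs_trunc_sub_le (condCdf_nonneg κ _) (condCdf_le_one κ _))

theorem empSq_trunc_sub_mem_Icc (κ : Kernel ℝ ℝ) [IsMarkovKernel κ] (d : Fin n → ℝ × ℝ)
    (s : ℝ × ℝ → ℝ) : empSq d (trunc s - condCdf κ) ∈ Icc 0 1 := by
  unfold empSq
  refine ⟨by positivity, ?_⟩
  have h : ∑ i, (trunc s - condCdf κ) (d i) ^ 2 ≤ n := by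
    calc ∑ i, (trunc s - condCdf κ) (d i) ^ 2 ≤ ∑ _i : Fin n, (1 : ℝ) := by
          refine Finset.sum_le_sum fun i _ => (sq_le_one_iff_abs_le_one _).2 (abs_le.2 ?_)
          have h := trunc_mem_Icc s (d i)
          have h0 := condCdf_nonneg κ (d i)
          have h1 := condCdf_le_one κ (d i)
          simp only [Pi.sub_apply]
          exact ⟨by linarith [h.1], by linarith [h.2]⟩
      _ = n := by simp
  rw [one_div, ← div_eq_inv_mul]
  exact div_le_one_of_le₀ h n.cast_nonneg

end Design

/-! ### Tensor models restricted to the design, and their weights. -/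

section Models

variable {a₁ b₁ a₂ b₂ : ℝ} (M₁ : ModelCollection.{u} a₁ b₁) (M₂ : ModelCollection.{u} a₂ b₂)
variable {n : ℕ}

/-- The number `D_m = D_{m₁} D_{m₂}` of products of basis functions in the model `m`. -/
def tensorDim (n : ℕ) (m : M₁.ι n × M₂.ι n) : ℕ := M₁.dim n m.1 * M₂.dim n m.2

theorem mul_penalty (hn : 1 ≤ n) (θ : ℝ) (m : M₁.ι n × M₂.ι n) :
    (n : ℝ) * penalty M₁ M₂ θ n m = θ / 4 * tensorDim M₁ M₂ n m := by
  have : (n : ℝ) ≠ 0 := by positivity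
  unfold penalty tensorDim
  field_simp

/-- The values at the design points of the products of basis functions. -/
noncomputable def modelVec (m : M₁.ι n × M₂.ι n) (d : Fin n → ℝ × ℝ)
    (kl : Fin (M₁.dim n m.1) × Fin (M₂.dim n m.2)) : EuclideanSpace ℝ (Fin n) :=
  designVec d fun p => M₁.basis n m.1 kl.1 p.1 * M₂.basis n m.2 kl.2 p.2

/-- The values at the design points of the functions of the model `m`. -/
noncomputable def designModel (m : M₁.ι n × M₂.ι n) (d : Fin n → ℝ × ℝ) :
    Submodule ℝ (EuclideanSpace ℝ (Fin n)) :=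
  (tensorModel M₁ M₂ n m).map (designVec d)

theorem designModel_eq_span (m : M₁.ι n × M₂.ι n) (d : Fin n → ℝ × ℝ) :
    designModel M₁ M₂ m d = Submodule.span ℝ (range (modelVec M₁ M₂ m d)) := by
  rw [designModel, tensorModel, Submodule.map_span, ← range_comp]
  rfl

theorem designModel_sup_eq_span (m m' : M₁.ι n × M₂.ι n) (d : Fin n → ℝ × ℝ) :
    designModel M₁ M₂ m d ⊔ designModel M₁ M₂ m' d
      = Submodule.span ℝ (range (Sum.elim (modelVec M₁ M₂ m d) (modelVec M₁ M₂ m' d))) := by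
  rw [designModel_eq_span, designModel_eq_span, Sum.elim_range, Submodule.span_union]

theorem finrank_designModel_le (m : M₁.ι n × M₂.ι n) (d : Fin n → ℝ × ℝ) :
    Module.finrank ℝ (designModel M₁ M₂ m d) ≤ tensorDim M₁ M₂ n m := by
  rw [designModel_eq_span]
  refine (finrank_range_le_card (R := ℝ) _).trans_eq ?_
  simp [tensorDim]

theorem finrank_designModel_sup_le (m m' : M₁.ι n × M₂.ι n) (d : Fin n → ℝ × ℝ) :
    Module.finrank ℝ ↥(designModel M₁ M₂ m d ⊔ designModel M₁ M₂ m' d)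
      ≤ tensorDim M₁ M₂ n m + tensorDim M₁ M₂ n m' :=
  (Submodule.finrank_add_le_finrank_add_finrank _ _).trans
    (add_le_add (finrank_designModel_le M₁ M₂ m d) (finrank_designModel_le M₁ M₂ m' d))

theorem designModel_eq_bot {m : M₁.ι n × M₂.ι n} (hm : tensorDim M₁ M₂ n m = 0)
    (d : Fin n → ℝ × ℝ) : designModel M₁ M₂ m d = ⊥ :=
  Submodule.finrank_eq_zero.1 (Nat.le_zero.1 (hm ▸ finrank_designModel_le M₁ M₂ m d))

theorem measurable_modelVec (m : M₁.ι n × M₂.ι n)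
    (kl : Fin (M₁.dim n m.1) × Fin (M₂.dim n m.2)) :
    Measurable fun d : Fin n → ℝ × ℝ => modelVec M₁ M₂ m d kl :=
  measurable_designVec (((M₁.measurable n m.1 kl.1).comp measurable_fst).mul
    ((M₂.measurable n m.2 kl.2).comp measurable_snd))

/-- A finite sum of positive weights has countably many terms. Countability gives measurable suprema
over models and almost sure statements for all models at once. -/
theorem ModelCollection.HypH.countable {a b : ℝ} {M : ModelCollection.{u} a b} {B : ℝ → ℝ}
    (hM : M.HypH B) (hn : 1 ≤ n) : Countable (M.ι n) := by
  have h := Summable.countable_support_ennreal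
    (ne_top_of_le_ne_top ENNReal.ofReal_ne_top (hM 1 one_pos n hn))
  have h2 : (Function.support fun m : M.ι n =>
      ENNReal.ofReal (Real.exp (-1 * √(M.dim n m : ℝ)))) = univ := by
    ext m
    simp [Real.exp_pos]
  rw [h2] at h
  exact countable_univ_iff.1 h

theorem sqrt_le_self_of_one_le {x : ℝ} (hx : 1 ≤ x) : √x ≤ x :=
  Real.sqrt_le_iff.2 ⟨by linarith, by nlinarith⟩

/-- The models of positive dimension have summable exponential weights. -/
theorem tsum_exp_neg_tensorDim_le {B₁ B₂ : ℝ → ℝ} (h₁ : M₁.HypH B₁) (h₂ : M₂.HypH B₂)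
    (hn : 1 ≤ n) {c : ℝ} (hc : 0 < c) :
    ∑' m : M₁.ι n × M₂.ι n, (if tensorDim M₁ M₂ n m = 0 then 0 else
        ENNReal.ofReal (Real.exp (-c * tensorDim M₁ M₂ n m)))
      ≤ ENNReal.ofReal (B₁ (c / 2)) * ENNReal.ofReal (B₂ (c / 2)) := by
  calc _ ≤ ∑' m : M₁.ι n × M₂.ι n,
        ENNReal.ofReal (Real.exp (-(c / 2) * √(M₁.dim n m.1 : ℝ))) *
          ENNReal.ofReal (Real.exp (-(c / 2) * √(M₂.dim n m.2 : ℝ))) := by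
        refine ENNReal.tsum_le_tsum fun m => ?_
        split_ifs with h
        · exact zero_le
        rw [← ENNReal.ofReal_mul (Real.exp_pos _).le, ← Real.exp_add]
        refine ENNReal.ofReal_le_ofReal (Real.exp_le_exp.2 ?_)
        obtain ⟨h1, h2⟩ := Nat.mul_ne_zero_iff.1 h
        have h1' : (1 : ℝ) ≤ M₁.dim n m.1 := by exact_mod_cast Nat.one_le_iff_ne_zero.2 h1
        have h2' : (1 : ℝ) ≤ M₂.dim n m.2 := by exact_mod_cast Nat.one_le_iff_ne_zero.2 h2
        have s1 : √(M₁.dim n m.1 : ℝ) ≤ M₁.dim n m.1 := sqrt_le_self_of_one_le h1'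
        have s2 : √(M₂.dim n m.2 : ℝ) ≤ M₂.dim n m.2 := sqrt_le_self_of_one_le h2'
        -- For dimensions at least one, each root is at most the product of the dimensions. The
        -- factor `2` is why (H) is used at `c / 2`.
        have h3 : √(M₁.dim n m.1 : ℝ) + √(M₂.dim n m.2 : ℝ) ≤ 2 * tensorDim M₁ M₂ n m := by
          rw [tensorDim, Nat.cast_mul]
          nlinarith
        nlinarith
    _ = (∑' m, ENNReal.ofReal (Real.exp (-(c / 2) * √(M₁.dim n m : ℝ)))) *
          ∑' m, ENNReal.ofReal (Real.exp (-(c / 2) * √(M₂.dim n m : ℝ))) := by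
        rw [ENNReal.tsum_prod (f := fun m₁ m₂ =>
          ENNReal.ofReal (Real.exp (-(c / 2) * √(M₁.dim n m₁ : ℝ))) *
            ENNReal.ofReal (Real.exp (-(c / 2) * √(M₂.dim n m₂ : ℝ))))]
        simp_rw [ENNReal.tsum_mul_left, ENNReal.tsum_mul_right]
    _ ≤ _ := mul_le_mul' (h₁ _ (half_pos hc) n hn) (h₂ _ (half_pos hc) n hn)

end Models

end CurrentStatus

namespace CurrentStatus

/-! ### The excess of noise and its expectation. -/

section Excess

variable {a₁ b₁ a₂ b₂ : ℝ} (M₁ : ModelCollection.{u} a₁ b₁) (M₂ : ModelCollection.{u} a₂ b₂)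
variable {n : ℕ} (κ : Kernel ℝ ℝ) (a θ : ℝ)

/-- The part of the noise captured by `S_m + S_{m'}` that the penalties do not compensate. -/
noncomputable def excess (m m' : M₁.ι n × M₂.ι n) (d : Fin n → ℝ × ℝ) (y : Fin n → ℝ) : ℝ :=
  max 0 (a * ‖(designModel M₁ M₂ m d ⊔ designModel M₁ M₂ m' d).starProjection (noise κ d y)‖ ^ 2
    - (θ / 4 * tensorDim M₁ M₂ n m + θ / 4 * tensorDim M₁ M₂ n m'))

/-- The largest excess over all models `m'`. -/
noncomputable def supExcess (m : M₁.ι n × M₂.ι n) (d : Fin n → ℝ × ℝ) (y : Fin n → ℝ) : ℝ :=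
  ⨆ m', excess M₁ M₂ κ a θ m m' d y

/-- The squared empirical distance from `F` to the model `m`. -/
noncomputable def bias (m : M₁.ι n × M₂.ι n) (d : Fin n → ℝ × ℝ) : ℝ :=
  1 / (n : ℝ) * (‖designVec d (condCdf κ)‖ ^ 2
    - ‖(designModel M₁ M₂ m d).starProjection (designVec d (condCdf κ))‖ ^ 2)

variable {M₁ M₂ κ a θ}

theorem excess_nonneg (m m' : M₁.ι n × M₂.ι n) (d : Fin n → ℝ × ℝ) (y : Fin n → ℝ) :
    0 ≤ excess M₁ M₂ κ a θ m m' d y := le_max_left _ _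

/-- Crude, but uniform in `m'`: it makes the real supremum over models meaningful and integrable. -/
theorem excess_le [IsMarkovKernel κ] (ha : 0 ≤ a) (hθ : 0 ≤ θ) (m m' : M₁.ι n × M₂.ι n)
    (d : Fin n → ℝ × ℝ) (y : Fin n → ℝ) : excess M₁ M₂ κ a θ m m' d y ≤ a * n := by
  refine max_le (by positivity) ?_
  have h1 : ‖(designModel M₁ M₂ m d ⊔ designModel M₁ M₂ m' d).starProjection (noise κ d y)‖ ^ 2
      ≤ n := (pow_le_pow_left₀ (norm_nonneg _)
    (Submodule.norm_starProjection_apply_le _ _) 2).trans (norm_sq_noise_le κ d y)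
  have h2 : 0 ≤ θ / 4 * tensorDim M₁ M₂ n m + θ / 4 * tensorDim M₁ M₂ n m' := by positivity
  nlinarith

theorem bddAbove_excess [IsMarkovKernel κ] (ha : 0 ≤ a) (hθ : 0 ≤ θ) (m : M₁.ι n × M₂.ι n)
    (d : Fin n → ℝ × ℝ) (y : Fin n → ℝ) :
    BddAbove (range fun m' => excess M₁ M₂ κ a θ m m' d y) :=
  ⟨a * n, by rintro _ ⟨m', rfl⟩; exact excess_le ha hθ m m' d y⟩

theorem supExcess_mem_Icc [IsMarkovKernel κ] (ha : 0 ≤ a) (hθ : 0 ≤ θ) (m : M₁.ι n × M₂.ι n)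
    (d : Fin n → ℝ × ℝ) (y : Fin n → ℝ) : supExcess M₁ M₂ κ a θ m d y ∈ Icc 0 (a * n) := by
  have : Nonempty (M₁.ι n × M₂.ι n) := ⟨m⟩
  exact ⟨Real.iSup_nonneg fun m' => excess_nonneg m m' d y,
    ciSup_le fun m' => excess_le ha hθ m m' d y⟩

theorem measurable_excess [IsMarkovKernel κ] (m m' : M₁.ι n × M₂.ι n) :
    Measurable fun q : (Fin n → ℝ × ℝ) × (Fin n → ℝ) => excess M₁ M₂ κ a θ m m' q.1 q.2 := by
  unfold excess
  simp_rw [designModel_sup_eq_span]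
  refine measurable_const.max (((measurable_norm_sq_starProjection_span ?_
    (measurable_noise κ)).const_mul a).sub_const _)
  rintro (kl | kl)
  · exact (measurable_modelVec M₁ M₂ m kl).comp measurable_fst
  · exact (measurable_modelVec M₁ M₂ m' kl).comp measurable_fst

theorem measurable_supExcess [IsMarkovKernel κ] [Countable (M₁.ι n)] [Countable (M₂.ι n)]
    (m : M₁.ι n × M₂.ι n) :
    Measurable fun q : (Fin n → ℝ × ℝ) × (Fin n → ℝ) => supExcess M₁ M₂ κ a θ m q.1 q.2 :=
  Measurable.iSup fun m' => measurable_excess m m'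

theorem measurable_bias [IsMarkovKernel κ] (m : M₁.ι n × M₂.ι n) :
    Measurable fun d : Fin n → ℝ × ℝ => bias M₁ M₂ κ m d := by
  have hF : Measurable fun d : Fin n → ℝ × ℝ => designVec d (condCdf κ) :=
    measurable_designVec (measurable_condCdf κ)
  unfold bias
  simp_rw [designModel_eq_span]
  exact ((hF.norm.pow_const 2).sub (measurable_norm_sq_starProjection_span
    (measurable_modelVec M₁ M₂ m) hF)).const_mul _

/-- Pythagoras. The difference of squares defining `bias` is the form whose measurability is at
hand. -/
theorem norm_sq_designVec_sub_starProjection (m : M₁.ι n × M₂.ι n) (d : Fin n → ℝ × ℝ) :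
    1 / (n : ℝ) * ‖designVec d (condCdf κ)
      - (designModel M₁ M₂ m d).starProjection (designVec d (condCdf κ))‖ ^ 2
      = bias M₁ M₂ κ m d := by
  have h1 := two_mul_inner_starProjection_sub_norm_sq (designModel M₁ M₂ m d)
    (designVec d (condCdf κ))
  rw [bias, norm_sub_sq_real]
  congr 1
  linarith

theorem bias_le_empSq (m : M₁.ι n × M₂.ι n) (d : Fin n → ℝ × ℝ) {s : ℝ × ℝ → ℝ}
    (hs : s ∈ tensorModel M₁ M₂ n m) : bias M₁ M₂ κ m d ≤ empSq d (condCdf κ - s) := by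
  have h1 := two_mul_inner_sub_norm_sq_le (designModel M₁ M₂ m d) (designVec d (condCdf κ))
    (Submodule.mem_map_of_mem hs)
  rw [empSq_eq_norm_sq, map_sub, norm_sub_sq_real, bias]
  refine mul_le_mul_of_nonneg_left ?_ (by positivity)
  linarith

theorem bias_mem_Icc [IsMarkovKernel κ] (m : M₁.ι n × M₂.ι n) (d : Fin n → ℝ × ℝ) :
    bias M₁ M₂ κ m d ∈ Icc 0 1 := by
  constructor
  · rw [← norm_sq_designVec_sub_starProjection]
    positivity
  · refine (bias_le_empSq m d (Submodule.zero_mem _)).trans ?_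
    rw [sub_zero, empSq, one_div, ← div_eq_inv_mul]
    refine div_le_one_of_le₀ ?_ n.cast_nonneg
    calc ∑ i, condCdf κ (d i) ^ 2 ≤ ∑ _i : Fin n, (1 : ℝ) :=
          Finset.sum_le_sum fun i _ => pow_le_one₀ (condCdf_nonneg κ _) (condCdf_le_one κ _)
      _ = n := by simp

/-- The loss of the selected estimator is bounded by the oracle risk up to the excess of noise. -/
theorem empSq_trunc_sub_le_of_penalized_min [IsMarkovKernel κ] (hn : 1 ≤ n) (ha : 1 < a)
    (hθ : 0 ≤ θ) (d : Fin n → ℝ × ℝ) (y : Fin n → ℝ) (fit : M₁.ι n × M₂.ι n → ℝ × ℝ → ℝ)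
    (sel : M₁.ι n × M₂.ι n) (hmem : ∀ m, fit m ∈ tensorModel M₁ M₂ n m)
    (hmin : ∀ m, ∀ s ∈ tensorModel M₁ M₂ n m,
      contrast d (fun i => status (y i) (d i).2) (fit m)
        ≤ contrast d (fun i => status (y i) (d i).2) s)
    (hsel : ∀ m, contrast d (fun i => status (y i) (d i).2) (fit sel) + penalty M₁ M₂ θ n sel
        ≤ contrast d (fun i => status (y i) (d i).2) (fit m) + penalty M₁ M₂ θ n m)
    (m : M₁.ι n × M₂.ι n) :
    empSq d (trunc (fit sel) - condCdf κ)
      ≤ 2 * a / (a - 1) * (2 + (a + 1) / (a * (a - 1)))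
          * (bias M₁ M₂ κ m d + penalty M₁ M₂ θ n m)
        + 2 * a / (a - 1) / n * supExcess M₁ M₂ κ a θ m d y := by
  have hn0 : (0 : ℝ) < n := by positivity
  -- The competitor is a function of the model whose values at the design points are the projection
  -- of those of `F`.
  obtain ⟨s, hs, hsv⟩ := (designModel M₁ M₂ m d).starProjection_apply_mem
    (designVec d (condCdf κ))
  have hle : contrast d (fun i => status (y i) (d i).2) (fit sel) + penalty M₁ M₂ θ n sel
      ≤ contrast d (fun i => status (y i) (d i).2) s + penalty M₁ M₂ θ n m :=
    (hsel m).trans (by gcongr; exact hmin m s hs)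
  rw [contrast_status_eq κ, contrast_status_eq κ] at hle
  have hle' := mul_le_mul_of_nonneg_left hle hn0.le
  rw [mul_add, mul_add, ← mul_assoc, ← mul_assoc, mul_one_div_cancel hn0.ne', one_mul, one_mul,
    mul_penalty M₁ M₂ hn, mul_penalty M₁ M₂ hn] at hle'
  have key := norm_sq_sub_le_of_penalized_min (designModel M₁ M₂ m d ⊔ designModel M₁ M₂ sel d)
    (Submodule.mem_sup_left (Submodule.mem_map_of_mem hs))
    (Submodule.mem_sup_right (Submodule.mem_map_of_mem (hmem sel))) ha (by positivity) hle'
  refine (empSq_trunc_sub_le κ d (fit sel)).trans ?_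
  have hsup : excess M₁ M₂ κ a θ m sel d y ≤ supExcess M₁ M₂ κ a θ m d y :=
    le_ciSup (bddAbove_excess (by linarith) hθ m d y) sel
  have hb := norm_sq_designVec_sub_starProjection (κ := κ) m d
  have ha0 : 0 < a - 1 := by linarith
  calc 1 / (n : ℝ) * ‖designVec d (condCdf κ) - designVec d (fit sel)‖ ^ 2
      ≤ 1 / (n : ℝ) * (2 * a / (a - 1) * (2 + (a + 1) / (a * (a - 1)))
          * (‖designVec d (condCdf κ) - designVec d s‖ ^ 2 + θ / 4 * tensorDim M₁ M₂ n m)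
          + 2 * a / (a - 1) * excess M₁ M₂ κ a θ m sel d y) :=
        mul_le_mul_of_nonneg_left key (by positivity)
    _ = 2 * a / (a - 1) * (2 + (a + 1) / (a * (a - 1)))
          * (bias M₁ M₂ κ m d + penalty M₁ M₂ θ n m)
        + 2 * a / (a - 1) / n * excess M₁ M₂ κ a θ m sel d y := by
        rw [hsv, ← mul_penalty M₁ M₂ hn, ← hb]
        field_simp
    _ ≤ _ := by gcongr

theorem lintegral_excess_le [IsMarkovKernel κ] (ha : 0 < a) (haθ : a < θ) (m m' : M₁.ι n × M₂.ι n)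
    (d : Fin n → ℝ × ℝ) :
    ∫⁻ y, ENNReal.ofReal (excess M₁ M₂ κ a θ m m' d y) ∂Measure.pi (fun i => κ (d i).1)
      ≤ ENNReal.ofReal (a * θ / (θ - a)) *
        ENNReal.ofReal (Real.exp (-((θ - a) ^ 2 / (4 * a * (θ + a))) * tensorDim M₁ M₂ n m')) := by
  have hθ : 0 < θ := ha.trans haθ
  have hd : 0 < θ - a := by linarith
  have h := lintegral_mul_norm_sq_starProjection_sub_le (Measure.pi fun i => κ (d i).1)
    (noise κ d) ((measurable_noise κ).comp measurable_prodMk_left)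
    (lintegral_exp_inner_noise_le κ d) _ (finrank_designModel_sup_le M₁ M₂ m m' d) ha haθ
  rw [← ENNReal.ofReal_mul (by positivity)]
  calc _ = ∫⁻ y, ENNReal.ofReal (a * ‖(designModel M₁ M₂ m d ⊔
          designModel M₁ M₂ m' d).starProjection (noise κ d y)‖ ^ 2
          - θ * (tensorDim M₁ M₂ n m + tensorDim M₁ M₂ n m' : ℕ) / 4)
          ∂Measure.pi (fun i => κ (d i).1) := by
        refine lintegral_congr fun y => ?_
        rw [excess, ENNReal.ofReal_max, ENNReal.ofReal_zero, max_eq_right zero_le]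
        congr 2
        push_cast
        ring
    _ ≤ _ := h
    _ ≤ _ := by
        -- The factor decaying in `D_m` is discarded; only the decay in `D_{m'}` is summed.
        refine ENNReal.ofReal_le_ofReal ?_
        have h1 : 0 < (θ - a) ^ 2 / (4 * a * (θ + a)) := by positivity
        refine mul_le_mul_of_nonneg_left (Real.exp_le_exp.2 ?_) (by positivity)
        refine mul_le_mul_of_nonpos_left ?_ (by linarith)
        exact_mod_cast le_add_self

theorem excess_eq_of_tensorDim_eq_zero (m : M₁.ι n × M₂.ι n) {m₁ m₂ : M₁.ι n × M₂.ι n}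
    (h₁ : tensorDim M₁ M₂ n m₁ = 0) (h₂ : tensorDim M₁ M₂ n m₂ = 0) (d : Fin n → ℝ × ℝ)
    (y : Fin n → ℝ) : excess M₁ M₂ κ a θ m m₁ d y = excess M₁ M₂ κ a θ m m₂ d y := by
  simp only [excess, designModel_eq_bot M₁ M₂ h₁, designModel_eq_bot M₁ M₂ h₂, h₁, h₂]

/-- The supremum is bounded by a sum, except over models with `D_{m'} = 0`. These have weight one
and may be infinitely many (one factor zero, the other arbitrary), but all give the zero subspace
and the same excess. Counting them once produces the term `1`. -/
theorem lintegral_supExcess_le [IsMarkovKernel κ] (hn : 1 ≤ n) {B₁ B₂ : ℝ → ℝ}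
    (h₁ : M₁.HypH B₁) (h₂ : M₂.HypH B₂) (ha : 0 < a) (haθ : a < θ) {c : ℝ}
    (hc : c = (θ - a) ^ 2 / (4 * a * (θ + a))) (m : M₁.ι n × M₂.ι n) (d : Fin n → ℝ × ℝ) :
    ∫⁻ y, ENNReal.ofReal (supExcess M₁ M₂ κ a θ m d y) ∂Measure.pi (fun i => κ (d i).1)
      ≤ ENNReal.ofReal (a * θ / (θ - a)) *
        (1 + ENNReal.ofReal (B₁ (c / 2)) * ENNReal.ofReal (B₂ (c / 2))) := by
  have hθ : 0 < θ := ha.trans haθ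
  have hd : 0 < θ - a := by linarith
  have hc0 : 0 < c := by rw [hc]; positivity
  have := h₁.countable hn
  have := h₂.countable hn
  have hmeas : ∀ m' : M₁.ι n × M₂.ι n, Measurable fun y =>
      ENNReal.ofReal (excess M₁ M₂ κ a θ m m' d y) := fun m' =>
    ((measurable_excess m m').comp measurable_prodMk_left).ennreal_ofReal
  have hsum : ∫⁻ y, ∑' m' : M₁.ι n × M₂.ι n, (if tensorDim M₁ M₂ n m' = 0 then 0 else
        ENNReal.ofReal (excess M₁ M₂ κ a θ m m' d y)) ∂Measure.pi (fun i => κ (d i).1)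
      ≤ ENNReal.ofReal (a * θ / (θ - a)) *
        (ENNReal.ofReal (B₁ (c / 2)) * ENNReal.ofReal (B₂ (c / 2))) := by
    rw [lintegral_tsum]
    · refine le_trans ?_ (mul_le_mul_right (tsum_exp_neg_tensorDim_le M₁ M₂ h₁ h₂ hn hc0) _)
      rw [← ENNReal.tsum_mul_left]
      refine ENNReal.tsum_le_tsum fun m' => ?_
      split_ifs
      · simp
      · rw [hc]
        exact lintegral_excess_le ha haθ m m' d
    · intro m'
      split_ifs
      · exact aemeasurable_const
      · exact (hmeas m').aemeasurable
  have hbound : ∀ (y : Fin n → ℝ) (t : ENNReal), (∀ m', ENNReal.ofReal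
      (excess M₁ M₂ κ a θ m m' d y) ≤ t) → ENNReal.ofReal (supExcess M₁ M₂ κ a θ m d y) ≤ t := by
    intro y t ht
    have : Nonempty (M₁.ι n × M₂.ι n) := ⟨m⟩
    rcases eq_or_ne t ⊤ with rfl | htop
    · exact le_top
    · rw [ENNReal.ofReal_le_iff_le_toReal htop]
      exact ciSup_le fun m' => (ENNReal.ofReal_le_iff_le_toReal htop).1 (ht m')
  have hterm : ∀ (y : Fin n → ℝ) (m' : M₁.ι n × M₂.ι n), tensorDim M₁ M₂ n m' ≠ 0 →
      ENNReal.ofReal (excess M₁ M₂ κ a θ m m' d y) ≤ ∑' m' : M₁.ι n × M₂.ι n,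
        (if tensorDim M₁ M₂ n m' = 0 then 0 else
          ENNReal.ofReal (excess M₁ M₂ κ a θ m m' d y)) := by
    intro y m' hm'
    refine le_trans (le_of_eq ?_) (ENNReal.le_tsum m')
    rw [if_neg hm']
  by_cases hzero : ∃ m₀ : M₁.ι n × M₂.ι n, tensorDim M₁ M₂ n m₀ = 0
  · obtain ⟨m₀, hm₀⟩ := hzero
    have h0 := lintegral_excess_le (κ := κ) ha haθ m m₀ d
    rw [hm₀, Nat.cast_zero, mul_zero, Real.exp_zero, ENNReal.ofReal_one] at h0
    rw [mul_add]
    refine le_trans ?_ (add_le_add h0 hsum)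
    rw [← lintegral_add_left (hmeas m₀)]
    refine lintegral_mono fun y => hbound y _ fun m' => ?_
    by_cases hm' : tensorDim M₁ M₂ n m' = 0
    · rw [excess_eq_of_tensorDim_eq_zero m hm' hm₀]
      exact le_self_add
    · exact (hterm y m' hm').trans le_add_self
  · push Not at hzero
    refine le_trans ((lintegral_mono fun y => hbound y _ fun m' => hterm y m' (hzero m')).trans
      hsum) ?_
    gcongr
    exact le_add_self

theorem integral_supExcess_le [IsMarkovKernel κ] (hn : 1 ≤ n) {B₁ B₂ : ℝ → ℝ}
    (h₁ : M₁.HypH B₁) (h₂ : M₂.HypH B₂) (ha : 0 < a) (haθ : a < θ) {c : ℝ}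
    (hc : c = (θ - a) ^ 2 / (4 * a * (θ + a))) (m : M₁.ι n × M₂.ι n) (d : Fin n → ℝ × ℝ) :
    ∫ y, supExcess M₁ M₂ κ a θ m d y ∂Measure.pi (fun i => κ (d i).1)
      ≤ a * θ / (θ - a) * (1 + max 0 (B₁ (c / 2)) * max 0 (B₂ (c / 2))) := by
  have hd : 0 < θ - a := by linarith
  have hθ : 0 < θ := by linarith
  have := h₁.countable hn
  have := h₂.countable hn
  rw [integral_eq_lintegral_of_nonneg_ae
    (Filter.Eventually.of_forall fun y => (supExcess_mem_Icc ha.le hθ.le m d y).1)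
    ((measurable_supExcess m).comp measurable_prodMk_left).aestronglyMeasurable]
  refine ENNReal.toReal_le_of_le_ofReal (by positivity) ?_
  refine (lintegral_supExcess_le hn h₁ h₂ ha haθ hc m d).trans_eq ?_
  rw [ENNReal.ofReal_mul (by positivity), ENNReal.ofReal_add zero_le_one (by positivity),
    ENNReal.ofReal_mul (by positivity), ENNReal.ofReal_one]
  simp [ENNReal.ofReal_max]

end Excess

end CurrentStatus

/-! ### Conditional expectations identified on π-systems. -/

section ConditionalExpectation

variable {Ω β : Type*} [MeasurableSpace Ω] {mβ : MeasurableSpace β} {μ : Measure Ω}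

theorem setIntegral_preimage_eq_of_isPiSystem {Z : Ω → β} (hZ : Measurable Z) {f g : Ω → ℝ}
    (hf : Integrable f μ) (hg : Integrable g μ) {C : Set (Set β)}
    (hC : mβ = MeasurableSpace.generateFrom C) (hpi : IsPiSystem C)
    (huniv : ∫ ω, f ω ∂μ = ∫ ω, g ω ∂μ)
    (h : ∀ S ∈ C, ∫ ω in Z ⁻¹' S, f ω ∂μ = ∫ ω in Z ⁻¹' S, g ω ∂μ) {S : Set β}
    (hS : MeasurableSet S) : ∫ ω in Z ⁻¹' S, f ω ∂μ = ∫ ω in Z ⁻¹' S, g ω ∂μ := by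
  induction S, hS using MeasurableSpace.induction_on_inter hC hpi with
  | empty => simp
  | basic t ht => exact h t ht
  | compl t ht ih =>
    have h1 := integral_add_compl (hZ ht) hf
    have h2 := integral_add_compl (hZ ht) hg
    rw [preimage_compl]
    linarith
  | iUnion t hd ht ih =>
    have hd' : Pairwise (Function.onFun Disjoint fun i => Z ⁻¹' t i) := fun i j hij =>
      (hd hij).preimage Z
    rw [preimage_iUnion, integral_iUnion (fun i => hZ (ht i)) hd' hf.integrableOn,
      integral_iUnion (fun i => hZ (ht i)) hd' hg.integrableOn]
    simp_rw [ih]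

/-- A function of `Z` is the conditional expectation given `Z` as soon as the integrals agree on a
π-system. -/
theorem ae_eq_condExp_comap_of_isPiSystem [IsFiniteMeasure μ] {Z : Ω → β} (hZ : Measurable Z)
    {f g : Ω → ℝ} (hf : Integrable f μ) (hg : Integrable g μ)
    (hgm : StronglyMeasurable[mβ.comap Z] g) {C : Set (Set β)}
    (hC : mβ = MeasurableSpace.generateFrom C) (hpi : IsPiSystem C) (huniv : univ ∈ C)
    (h : ∀ S ∈ C, ∫ ω in Z ⁻¹' S, g ω ∂μ = ∫ ω in Z ⁻¹' S, f ω ∂μ) :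
    g =ᵐ[μ] μ[f | mβ.comap Z] := by
  refine ae_eq_condExp_of_forall_setIntegral_eq hZ.comap_le hf (fun _ _ _ => hg.integrableOn) ?_
    hgm.aestronglyMeasurable
  rintro _ ⟨S, hS, rfl⟩ _
  exact setIntegral_preimage_eq_of_isPiSystem hZ hg hf hC hpi (by simpa using h univ huniv) h hS

end ConditionalExpectation

namespace CurrentStatus

/-! ### The conditional law of the lifetimes given the design. -/

section Kernels

variable {n : ℕ}

/-- The law of independent lifetimes `Y_i` with laws `κ (x_i)`, as a kernel of the design. -/
noncomputable def lifetimeKernel (κ : Kernel ℝ ℝ) [IsMarkovKernel κ] (n : ℕ) :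
    Kernel (Fin n → ℝ × ℝ) (Fin n → ℝ) where
  toFun d := Measure.pi fun i => κ (d i).1
  measurable' := by
    refine Measurable.measure_of_isPiSystem_of_isProbabilityMeasure generateFrom_pi.symm
      isPiSystem_pi ?_
    rintro _ ⟨s, hs, rfl⟩
    simp_rw [Measure.pi_pi]
    refine Finset.measurable_prod _ fun i _ => ?_
    exact (κ.measurable_coe (hs i (mem_univ i))).comp (by fun_prop)

theorem lifetimeKernel_apply (κ : Kernel ℝ ℝ) [IsMarkovKernel κ] (d : Fin n → ℝ × ℝ) :
    lifetimeKernel κ n d = Measure.pi fun i => κ (d i).1 := rfl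

instance (κ : Kernel ℝ ℝ) [IsMarkovKernel κ] : IsMarkovKernel (lifetimeKernel κ n) :=
  ⟨fun d => by rw [lifetimeKernel_apply]; infer_instance⟩

theorem measurable_prod_kernel_real (κ : Kernel ℝ ℝ) {s : Fin n → Set ℝ}
    (hs : ∀ i, MeasurableSet (s i)) : Measurable fun x : Fin n → ℝ => ∏ i, (κ (x i)).real (s i) :=
  Finset.measurable_prod _ fun i _ =>
    (κ.measurable_coe (hs i)).ennreal_toReal.comp (measurable_pi_apply i)

theorem prod_kernel_real_mem_Icc (κ : Kernel ℝ ℝ) [IsMarkovKernel κ] (s : Fin n → Set ℝ)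
    (x : Fin n → ℝ) : ∏ i, (κ (x i)).real (s i) ∈ Icc 0 1 :=
  ⟨Finset.prod_nonneg fun _ _ => measureReal_nonneg,
    Finset.prod_le_one (fun _ _ => measureReal_nonneg) fun _ _ => measureReal_le_one⟩

end Kernels

section DesignSigmaAlgebra

theorem comap_comp_le {Ω α β : Type*} [MeasurableSpace α] [mβ : MeasurableSpace β] {g : α → β}
    (hg : Measurable g) (f : Ω → α) :
    mβ.comap (fun ω => g (f ω)) ≤ MeasurableSpace.comap f inferInstance :=
  MeasurableSpace.comap_comp.symm.trans_le (MeasurableSpace.comap_mono hg.comap_le)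

theorem comap_design_eq {Ω : Type*} {n : ℕ} (X T : Fin n → Ω → ℝ) :
    MeasurableSpace.comap (fun ω i => (X i ω, T i ω))
        (inferInstance : MeasurableSpace (Fin n → ℝ × ℝ))
      = MeasurableSpace.comap (fun ω => (fun i => X i ω, fun i => T i ω))
        (inferInstance : MeasurableSpace ((Fin n → ℝ) × (Fin n → ℝ))) := by
  refine le_antisymm ?_ ?_
  · have : Measurable fun (q : (Fin n → ℝ) × (Fin n → ℝ)) i => (q.1 i, q.2 i) := by fun_prop
    exact comap_comp_le this (fun ω => (fun i => X i ω, fun i => T i ω))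
  · have : Measurable fun d : Fin n → ℝ × ℝ => (fun i => (d i).1, fun i => (d i).2) := by fun_prop
    exact comap_comp_le this (fun ω i => (X i ω, T i ω))

end DesignSigmaAlgebra

/-! ### Reduction of the sampling schemes to a random design. -/

section Sampling

variable {Ω : Type v} [MeasurableSpace Ω] {μ : Measure Ω} [IsProbabilityMeasure μ]
  {κ : Kernel ℝ ℝ} [IsMarkovKernel κ] {n : ℕ} {X Y T : Fin n → Ω → ℝ}

theorem integrable_prod_kernel_real (hX : ∀ i, Measurable (X i)) {s : Fin n → Set ℝ}
    (hs : ∀ i, MeasurableSet (s i)) : Integrable (fun ω => ∏ i, (κ (X i ω)).real (s i)) μ :=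
  Integrable.of_mem_Icc 0 1
    ((measurable_prod_kernel_real κ hs).comp (measurable_pi_lambda _ hX)).aemeasurable
    (Filter.Eventually.of_forall fun _ => prod_kernel_real_mem_Icc κ s _)

/-- Two probability measures that agree on the sets `A ×ˢ univ.pi s`: there the equality is
`condLaw` integrated over the event that the design lies in `A`. -/
theorem IsSampleOfDesign.map_eq_compProd (h : IsSampleOfDesign μ κ X Y T) :
    μ.map (fun ω => ((fun i => (X i ω, T i ω) : Fin n → ℝ × ℝ), fun i => Y i ω))
      = μ.map (fun ω i => (X i ω, T i ω)) ⊗ₘ lifetimeKernel κ n := by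
  have hD : Measurable fun ω => (fun i => (X i ω, T i ω) : Fin n → ℝ × ℝ) :=
    measurable_pi_lambda _ fun i => (h.measurable_X i).prodMk (h.measurable_T i)
  have hY : Measurable fun ω i => Y i ω := measurable_pi_lambda _ h.measurable_Y
  have : IsProbabilityMeasure (μ.map fun ω => (fun i => (X i ω, T i ω) : Fin n → ℝ × ℝ)) :=
    Measure.isProbabilityMeasure_map hD.aemeasurable
  have : IsProbabilityMeasure
      (μ.map (fun ω => ((fun i => (X i ω, T i ω) : Fin n → ℝ × ℝ), fun i => Y i ω))) :=
    Measure.isProbabilityMeasure_map (hD.prodMk hY).aemeasurable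
  refine ext_of_generate_finite _ (generateFrom_eq_prod
    (MeasurableSpace.generateFrom_measurableSet (α := Fin n → ℝ × ℝ))
    (generateFrom_pi (α := fun _ : Fin n => ℝ)) isCountablySpanning_measurableSet
    (IsCountablySpanning.pi fun _ => isCountablySpanning_measurableSet)).symm
    (MeasurableSpace.isPiSystem_measurableSet.prod isPiSystem_pi) ?_ (by simp)
  rintro _ ⟨A, hA, _, ⟨s, hs, rfl⟩, rfl⟩
  replace hA : MeasurableSet A := hA
  change μ.map _ (A ×ˢ univ.pi s) = (_ ⊗ₘ _) (A ×ˢ univ.pi s)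
  have hs' : ∀ i, MeasurableSet (s i) := fun i => hs i (mem_univ i)
  have hYs : MeasurableSet (⋂ i, Y i ⁻¹' s i) :=
    MeasurableSet.iInter fun i => h.measurable_Y i (hs' i)
  rw [Measure.compProd_apply_prod hA (MeasurableSet.univ_pi hs'),
    Measure.map_apply (hD.prodMk hY) (hA.prod (MeasurableSet.univ_pi hs')),
    setLIntegral_map hA ((lifetimeKernel κ n).measurable_coe (MeasurableSet.univ_pi hs')) hD]
  have hset : (fun ω => ((fun i => (X i ω, T i ω) : Fin n → ℝ × ℝ), fun i => Y i ω)) ⁻¹'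
      A ×ˢ univ.pi s = (⋂ i, Y i ⁻¹' s i) ∩ (fun ω i => (X i ω, T i ω)) ⁻¹' A := by
    ext ω
    simp [and_comm]
  have hker : ∀ ω, lifetimeKernel κ n (fun i => (X i ω, T i ω)) (univ.pi s)
      = ENNReal.ofReal (∏ i, (κ (X i ω)).real (s i)) := by
    intro ω
    rw [lifetimeKernel_apply, Measure.pi_pi,
      ENNReal.ofReal_prod_of_nonneg fun _ _ => measureReal_nonneg]
    simp
  simp_rw [hker]
  rw [← ofReal_integral_eq_lintegral_ofReal
    (integrable_prod_kernel_real h.measurable_X hs').integrableOn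
    (Filter.Eventually.of_forall fun ω => (prod_kernel_real_mem_Icc κ s fun i => X i ω).1),
    ← setIntegral_congr_ae (hD hA) ((h.condLaw s hs').mono fun _ hω _ => hω),
    setIntegral_condExp hD.comap_le ((integrable_const _).indicator hYs) ⟨A, hA, rfl⟩,
    setIntegral_indicator hYs, hset, inter_comm]
  simp

/-- The conditional expectation of a function of the design and the lifetimes. -/
theorem IsSampleOfDesign.condExp_ae_eq (h : IsSampleOfDesign μ κ X Y T)
    {f : (Fin n → ℝ × ℝ) × (Fin n → ℝ) → ℝ} (hf : Measurable f)
    (hint : Integrable (fun ω => f (fun i => (X i ω, T i ω), fun i => Y i ω)) μ) :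
    μ[fun ω => f (fun i => (X i ω, T i ω), fun i => Y i ω) |
        MeasurableSpace.comap (fun ω i => (X i ω, T i ω)) inferInstance]
      =ᵐ[μ] fun ω => ∫ y, f (fun i => (X i ω, T i ω), y) ∂Measure.pi fun i => κ (X i ω) := by
  have hD : Measurable fun ω => (fun i => (X i ω, T i ω) : Fin n → ℝ × ℝ) :=
    measurable_pi_lambda _ fun i => (h.measurable_X i).prodMk (h.measurable_T i)
  have hY : Measurable fun ω i => Y i ω := measurable_pi_lambda _ h.measurable_Y
  refine (condExp_prod_ae_eq_integral_condDistrib hD hY.aemeasurable hf.stronglyMeasurable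
    hint).trans ?_
  -- Uniqueness of disintegration identifies `condDistrib` with the product kernel.
  filter_upwards [ae_of_ae_map hD.aemeasurable
    (condDistrib_ae_eq_of_measure_eq_compProd_of_measurable hD hY h.map_eq_compProd)] with ω hω
  rw [hω, lifetimeKernel_apply]

theorem setIntegral_indicator_eq_of_hasCondDistrib {U V : Ω → ℝ} (hU : Measurable U)
    (hV : Measurable V) (h : HasCondDistrib V U κ μ) {A s : Set ℝ} (hA : MeasurableSet A)
    (hs : MeasurableSet s) :
    ∫ ω, A.indicator 1 (U ω) * s.indicator (1 : ℝ → ℝ) (V ω) ∂μ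
      = ∫ ω, A.indicator 1 (U ω) * (κ (U ω)).real s ∂μ := by
  have : IsProbabilityMeasure (μ.map U) := Measure.isProbabilityMeasure_map hU.aemeasurable
  have h1 : (fun ω => A.indicator 1 (U ω) * s.indicator (1 : ℝ → ℝ) (V ω))
      = (U ⁻¹' A ∩ V ⁻¹' s).indicator 1 := by
    ext ω
    by_cases hω : U ω ∈ A <;> by_cases hω' : V ω ∈ s <;> simp [hω, hω']
  have h2 : (fun ω => A.indicator 1 (U ω) * (κ (U ω)).real s)
      = (U ⁻¹' A).indicator fun ω => (κ (U ω)).real s := by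
    ext ω
    by_cases hω : U ω ∈ A <;> simp [hω]
  have h3 : μ (U ⁻¹' A ∩ V ⁻¹' s) = ∫⁻ ω in U ⁻¹' A, κ (U ω) s ∂μ := by
    have := congrArg (fun ν => ν (A ×ˢ s)) h.map_eq
    rwa [Measure.compProd_apply_prod hA hs, Measure.map_apply (hU.prodMk hV) (hA.prod hs),
      setLIntegral_map hA (κ.measurable_coe hs) hU] at this
  rw [h1, h2, integral_indicator_one ((hU hA).inter (hV hs)), integral_indicator (hU hA),
    measureReal_def, h3]
  exact (integral_toReal ((κ.measurable_coe hs).comp hU).aemeasurable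
    (Filter.Eventually.of_forall fun _ => measure_lt_top _ _)).symm

/-- On a box in `X` both integrals factor over `i` by independence of the triples, and the factors
agree by `condLaw`. -/
theorem IsIIDSample.condExp_lifetimes_ae_eq (h : IsIIDSample μ κ X Y T) {s : Fin n → Set ℝ}
    (hs : ∀ i, MeasurableSet (s i)) :
    (fun ω => ∏ i, (κ (X i ω)).real (s i)) =ᵐ[μ]
      μ⟦(fun ω i => Y i ω) ⁻¹' univ.pi s |
        MeasurableSpace.comap (fun ω i => X i ω) inferInstance⟧ := by
  have hX : Measurable fun ω i => X i ω := measurable_pi_lambda _ h.measurable_X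
  have hY : Measurable fun ω i => Y i ω := measurable_pi_lambda _ h.measurable_Y
  have hYs : MeasurableSet ((fun ω i => Y i ω) ⁻¹' univ.pi s) := hY (MeasurableSet.univ_pi hs)
  refine ae_eq_condExp_comap_of_isPiSystem hX ((integrable_const _).indicator hYs)
    (integrable_prod_kernel_real h.measurable_X hs)
    ((measurable_prod_kernel_real κ hs).comp (comap_measurable _)).stronglyMeasurable
    generateFrom_pi.symm isPiSystem_pi ⟨fun _ => univ, by simp, by simp⟩ ?_
  rintro _ ⟨A, hA, rfl⟩
  have hA' : ∀ i, MeasurableSet (A i) := fun i => hA i (mem_univ i)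
  have hXA : MeasurableSet ((fun ω i => X i ω) ⁻¹' univ.pi A) := hX (MeasurableSet.univ_pi hA')
  have htriple : ∀ i, Measurable fun ω => (X i ω, Y i ω, T i ω) := fun i =>
    (h.measurable_X i).prodMk ((h.measurable_Y i).prodMk (h.measurable_T i))
  have hone : ∀ {S : Set ℝ}, MeasurableSet S → Measurable (S.indicator (1 : ℝ → ℝ)) := fun hS =>
    measurable_one.indicator hS
  have hind : ∀ ω, (univ.pi A).indicator (1 : (Fin n → ℝ) → ℝ) (fun i => X i ω)
      = ∏ i, (A i).indicator 1 (X i ω) := by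
    intro ω
    by_cases hω : ∀ i, X i ω ∈ A i
    · simp [hω]
    · obtain ⟨i, hi⟩ := not_forall.1 hω
      rw [Finset.prod_eq_zero (Finset.mem_univ i) (by simp [hi]), indicator_of_notMem]
      exact fun hmem => hi (hmem i (mem_univ i))
  have hind' : ∀ ω, (univ.pi s).indicator (1 : (Fin n → ℝ) → ℝ) (fun i => Y i ω)
      = ∏ i, (s i).indicator 1 (Y i ω) := by
    intro ω
    by_cases hω : ∀ i, Y i ω ∈ s i
    · simp [hω]
    · obtain ⟨i, hi⟩ := not_forall.1 hω
      rw [Finset.prod_eq_zero (Finset.mem_univ i) (by simp [hi]), indicator_of_notMem]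
      exact fun hmem => hi (hmem i (mem_univ i))
  calc ∫ ω in (fun ω i => X i ω) ⁻¹' univ.pi A, ∏ i, (κ (X i ω)).real (s i) ∂μ
      = ∫ ω, ∏ i, ((A i).indicator 1 (X i ω) * (κ (X i ω)).real (s i)) ∂μ := by
        rw [← integral_indicator hXA]
        refine integral_congr_ae (Filter.Eventually.of_forall fun ω => ?_)
        simp only
        rw [Finset.prod_mul_distrib, ← hind]
        by_cases hω : (fun i => X i ω) ∈ univ.pi A
        · rw [indicator_of_mem (show ω ∈ _ from hω), indicator_of_mem hω, Pi.one_apply, one_mul]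
        · rw [indicator_of_notMem (show ω ∉ _ from hω), indicator_of_notMem hω, zero_mul]
    _ = ∏ i, ∫ ω, (A i).indicator 1 (X i ω) * (κ (X i ω)).real (s i) ∂μ :=
        h.indep.integral_fun_prod_comp
          (f := fun i q => (A i).indicator 1 q.1 * (κ q.1).real (s i))
          (fun i => (htriple i).aemeasurable) fun i => (((hone (hA' i)).comp measurable_fst).mul
            ((κ.measurable_coe (hs i)).ennreal_toReal.comp measurable_fst)).aestronglyMeasurable
    _ = ∏ i, ∫ ω, (A i).indicator 1 (X i ω) * (s i).indicator (1 : ℝ → ℝ) (Y i ω) ∂μ :=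
        Finset.prod_congr rfl fun i _ => (setIntegral_indicator_eq_of_hasCondDistrib
          (h.measurable_X i) (h.measurable_Y i) (h.condLaw i) (hA' i) (hs i)).symm
    _ = ∫ ω, ∏ i, ((A i).indicator 1 (X i ω) * (s i).indicator (1 : ℝ → ℝ) (Y i ω)) ∂μ :=
        (h.indep.integral_fun_prod_comp
          (f := fun i q => (A i).indicator 1 q.1 * (s i).indicator (1 : ℝ → ℝ) q.2.1)
          (fun i => (htriple i).aemeasurable) fun i => (((hone (hA' i)).comp measurable_fst).mul
            ((hone (hs i)).comp (measurable_fst.comp measurable_snd))).aestronglyMeasurable).symm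
    _ = _ := by
        rw [← integral_indicator hXA]
        refine integral_congr_ae (Filter.Eventually.of_forall fun ω => ?_)
        simp only
        rw [Finset.prod_mul_distrib, ← hind, ← hind']
        by_cases hω : (fun i => X i ω) ∈ univ.pi A
        · rw [indicator_of_mem (show ω ∈ _ from hω), indicator_of_mem hω, Pi.one_apply, one_mul]
          rfl
        · rw [indicator_of_notMem (show ω ∉ _ from hω), indicator_of_notMem hω, zero_mul]

/-- An i.i.d. sample has independent lifetimes with laws `κ (X_i)` given the design. -/
theorem IsIIDSample.isSampleOfDesign (h : IsIIDSample μ κ X Y T) : IsSampleOfDesign μ κ X Y T where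
  measurable_X := h.measurable_X
  measurable_Y := h.measurable_Y
  measurable_T := h.measurable_T
  condLaw s hs := by
    have hX : Measurable fun ω i => X i ω := measurable_pi_lambda _ h.measurable_X
    have hY : Measurable fun ω i => Y i ω := measurable_pi_lambda _ h.measurable_Y
    have hT : Measurable fun ω i => T i ω := measurable_pi_lambda _ h.measurable_T
    have hset : ⋂ i, Y i ⁻¹' s i = (fun ω i => Y i ω) ⁻¹' univ.pi s := by ext; simp
    have hYs : MeasurableSet ((fun ω i => Y i ω) ⁻¹' univ.pi s) := hY (MeasurableSet.univ_pi hs)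
    rw [hset, comap_design_eq]
    refine (ae_eq_condExp_comap_of_isPiSystem (hX.prodMk hT) ((integrable_const _).indicator hYs)
      (integrable_prod_kernel_real h.measurable_X hs)
      (((measurable_prod_kernel_real κ hs).comp measurable_fst).comp
        (comap_measurable _)).stronglyMeasurable
      generateFrom_prod.symm isPiSystem_prod ⟨univ, by simp, univ, by simp, by simp⟩ ?_).symm
    rintro _ ⟨A, hA, B, hB, rfl⟩
    set g : Ω → ℝ := fun ω => ∏ i, (κ (X i ω)).real (s i) with hg
    have hgm : StronglyMeasurable[MeasurableSpace.comap (fun ω i => X i ω) inferInstance] g :=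
      ((measurable_prod_kernel_real κ hs).comp (comap_measurable _)).stronglyMeasurable
    have hXA : MeasurableSet[MeasurableSpace.comap (fun ω i => X i ω) inferInstance] ((fun ω i => X i ω) ⁻¹' A) := ⟨A, hA, rfl⟩
    have hTB : MeasurableSet ((fun ω i => T i ω) ⁻¹' B) := hT hB
    have hpre : (fun ω => (fun i => X i ω, fun i => T i ω)) ⁻¹' A ×ˢ B
        = (fun ω i => X i ω) ⁻¹' A ∩ (fun ω i => T i ω) ⁻¹' B := rfl
    have hmul : g * ((fun ω i => T i ω) ⁻¹' B).indicator (fun _ => (1 : ℝ))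
        = ((fun ω i => T i ω) ⁻¹' B).indicator g := by
      ext ω
      by_cases hω : ω ∈ (fun ω i => T i ω) ⁻¹' B <;> simp [hω]
    have hgi : Integrable g μ := integrable_prod_kernel_real h.measurable_X hs
    -- Since `g` is a version of `P(Y ∈ s | X)`, pulling it out gives `E[g 1_B(T) | X] = P(Y ∈ s |
    -- X) P(T ∈ B | X)`. By conditional independence this is `P(Y ∈ s, T ∈ B | X)`, so adding `T` to
    -- the conditioning changes nothing.
    have hpull := condExp_mul_of_stronglyMeasurable_left (μ := μ) hgm
      (by rw [hmul]; exact hgi.indicator hTB) ((integrable_const (1 : ℝ)).indicator hTB)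
    rw [hmul] at hpull
    simp only [hpre]
    calc ∫ ω in (fun ω i => X i ω) ⁻¹' A ∩ (fun ω i => T i ω) ⁻¹' B, g ω ∂μ
        = ∫ ω in (fun ω i => X i ω) ⁻¹' A, ((fun ω i => T i ω) ⁻¹' B).indicator g ω ∂μ :=
          (setIntegral_indicator hTB).symm
      _ = ∫ ω in (fun ω i => X i ω) ⁻¹' A,
            (μ[((fun ω i => T i ω) ⁻¹' B).indicator g |
                MeasurableSpace.comap (fun ω i => X i ω) inferInstance]) ω ∂μ :=
          (setIntegral_condExp hX.comap_le (hgi.indicator hTB) hXA).symm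
      _ = ∫ ω in (fun ω i => X i ω) ⁻¹' A, (μ⟦(fun ω i => Y i ω) ⁻¹' univ.pi s ∩
            (fun ω i => T i ω) ⁻¹' B |
              MeasurableSpace.comap (fun ω i => X i ω) inferInstance⟧) ω ∂μ := by
          refine setIntegral_congr_ae (hX hA) ?_
          filter_upwards [hpull, h.condIndep _ _ (MeasurableSet.univ_pi hs) hB,
            h.condExp_lifetimes_ae_eq hs] with ω h1 h2 h3 _
          rw [h1, h2, ← h3, Pi.mul_apply]
      _ = ∫ ω in (fun ω i => X i ω) ⁻¹' A, ((fun ω i => Y i ω) ⁻¹' univ.pi s ∩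
            (fun ω i => T i ω) ⁻¹' B).indicator (fun _ => (1 : ℝ)) ω ∂μ :=
          setIntegral_condExp hX.comap_le ((integrable_const _).indicator (hYs.inter hTB)) hXA
      _ = _ := by
          rw [setIntegral_indicator (hYs.inter hTB), setIntegral_indicator hYs, inter_comm
            ((fun ω i => Y i ω) ⁻¹' univ.pi s), ← inter_assoc]

end Sampling

/-- A sample with a deterministic design is a sample of the constant random design. -/
theorem isSampleOfDesign_const {Ω : Type v} [MeasurableSpace Ω] {μ : Measure Ω}
    [IsProbabilityMeasure μ] {κ : Kernel ℝ ℝ} {n : ℕ} {Y : Fin n → Ω → ℝ} {x t : Fin n → ℝ} (hY : ∀ i, Measurable (Y i))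
    (hindep : iIndepFun Y μ) (hlaw : ∀ i, μ.map (Y i) = κ (x i)) :
    IsSampleOfDesign μ κ (fun i _ => x i) Y (fun i _ => t i) where
  measurable_X _ := measurable_const
  measurable_Y := hY
  measurable_T _ := measurable_const
  condLaw s hs := by
    have hYs : MeasurableSet (⋂ i, Y i ⁻¹' s i) := MeasurableSet.iInter fun i => hY i (hs i)
    have h := hindep.measure_inter_preimage_eq_mul Finset.univ (sets := s) fun i _ => hs i
    simp only [Finset.mem_univ, iInter_true] at h
    rw [MeasurableSpace.comap_const, condExp_bot]
    refine Filter.Eventually.of_forall fun ω => ?_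
    simp only
    rw [integral_indicator_const _ hYs, measureReal_def, h, ENNReal.toReal_prod, smul_eq_mul,
      mul_one]
    refine Finset.prod_congr rfl fun i _ => ?_
    rw [← hlaw, measureReal_def, Measure.map_apply (hY i) (hs i)]


end CurrentStatus

namespace CurrentStatus

/-! ### The oracle inequality. -/

section Oracle

variable {Ω : Type v} [MeasurableSpace Ω] {a₁ b₁ a₂ b₂ : ℝ} {M₁ : ModelCollection.{u} a₁ b₁}
  {M₂ : ModelCollection.{u} a₂ b₂} {κ : Kernel ℝ ℝ} [IsMarkovKernel κ] {θ : ℝ} {n : ℕ}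

theorem IsModelSelection.measurable_fit_sel [Countable (M₁.ι n)] [Countable (M₂.ι n)]
    {d : Ω → Fin n → ℝ × ℝ} {δ : Ω → Fin n → ℝ}
    {fit : Ω → M₁.ι n × M₂.ι n → ℝ × ℝ → ℝ} {sel : Ω → M₁.ι n × M₂.ι n}
    (h : IsModelSelection M₁ M₂ θ d δ fit sel) (i : Fin n) :
    Measurable fun ω => fit ω (sel ω) (d ω i) := by
  intro S hS
  have : (fun ω => fit ω (sel ω) (d ω i)) ⁻¹' S
      = ⋃ m, {ω | sel ω = m} ∩ (fun ω => fit ω m (d ω i)) ⁻¹' S := by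
    ext ω
    simp
  rw [this]
  exact MeasurableSet.iUnion fun m => (h.measurable_sel m).inter (h.measurable_fit m i hS)

theorem measurable_trunc_apply {s : Ω → ℝ × ℝ → ℝ} {p : Ω → ℝ × ℝ}
    (h : Measurable fun ω => s ω (p ω)) : Measurable fun ω => trunc (s ω) (p ω) :=
  Measurable.ite (measurableSet_lt h measurable_const) measurable_const
    (Measurable.ite (measurableSet_lt measurable_const h) measurable_const h)

theorem IsModelSelection.integrable_loss {μ : Measure Ω} [IsProbabilityMeasure μ]
    [Countable (M₁.ι n)] [Countable (M₂.ι n)]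
    {d : Ω → Fin n → ℝ × ℝ} {δ : Ω → Fin n → ℝ} (hd : Measurable d)
    {fit : Ω → M₁.ι n × M₂.ι n → ℝ × ℝ → ℝ} {sel : Ω → M₁.ι n × M₂.ι n}
    (h : IsModelSelection M₁ M₂ θ d δ fit sel) :
    Integrable (fun ω => empSq (d ω) (trunc (fit ω (sel ω)) - condCdf κ)) μ := by
  refine Integrable.of_mem_Icc 0 1 (Measurable.aemeasurable ?_)
    (Filter.Eventually.of_forall fun ω => empSq_trunc_sub_mem_Icc κ _ _)
  unfold empSq
  refine (Finset.measurable_sum _ fun i _ => Measurable.pow_const ?_ 2).const_mul _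
  exact (measurable_trunc_apply (h.measurable_fit_sel i)).sub
    ((measurable_condCdf κ).comp ((measurable_pi_apply i).comp hd))

/-- The conditional oracle inequality, for a noise level `a` strictly between `1` and `θ`. -/
theorem IsSampleOfDesign.condExp_loss_le {μ : Measure Ω} [IsProbabilityMeasure μ]
    {X Y T : Fin n → Ω → ℝ} (h : IsSampleOfDesign μ κ X Y T) (hn : 1 ≤ n) {B₁ B₂ : ℝ → ℝ}
    (h₁ : M₁.HypH B₁) (h₂ : M₂.HypH B₂) {a c : ℝ} (ha : 1 < a) (haθ : a < θ)
    (hc : c = (θ - a) ^ 2 / (4 * a * (θ + a)))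
    {fit : Ω → M₁.ι n × M₂.ι n → ℝ × ℝ → ℝ} {sel : Ω → M₁.ι n × M₂.ι n}
    (hsel : IsModelSelection M₁ M₂ θ (fun ω i => (X i ω, T i ω))
      (fun ω i => status (Y i ω) (T i ω)) fit sel) :
    μ[fun ω => empSq (fun i => (X i ω, T i ω)) (trunc (fit ω (sel ω)) - condCdf κ) |
        MeasurableSpace.comap (fun ω i => (X i ω, T i ω)) inferInstance]
      ≤ᵐ[μ] fun ω => oracleBound M₁ M₂ κ θ (2 * a / (a - 1) * (2 + (a + 1) / (a * (a - 1))))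
        (2 * a / (a - 1) * (a * θ / (θ - a) * (1 + max 0 (B₁ (c / 2)) * max 0 (B₂ (c / 2)))))
        (fun i => (X i ω, T i ω)) := by
  have := h₁.countable hn
  have := h₂.countable hn
  have hn0 : (0 : ℝ) < n := by positivity
  have ha0 : 0 < a - 1 := by linarith
  have hapos : 0 < a := by linarith
  have hθ : 0 < θ := by linarith
  have hD : Measurable fun ω => (fun i => (X i ω, T i ω) : Fin n → ℝ × ℝ) :=
    measurable_pi_lambda _ fun i => (h.measurable_X i).prodMk (h.measurable_T i)
  have hY : Measurable fun ω i => Y i ω := measurable_pi_lambda _ h.measurable_Y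
  set K := 2 * a / (a - 1) with hK
  set C := K * (2 + (a + 1) / (a * (a - 1))) with hC
  have hK0 : 0 < K := by positivity
  have hC0 : 0 < C := by positivity
  set R := a * θ / (θ - a) * (1 + max 0 (B₁ (c / 2)) * max 0 (B₂ (c / 2)))
  have key : ∀ m : M₁.ι n × M₂.ι n,
      μ[fun ω => empSq (fun i => (X i ω, T i ω)) (trunc (fit ω (sel ω)) - condCdf κ) |
        MeasurableSpace.comap (fun ω i => (X i ω, T i ω)) inferInstance]
      ≤ᵐ[μ] fun ω => C * (bias M₁ M₂ κ m (fun i => (X i ω, T i ω)) + penalty M₁ M₂ θ n m)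
        + K * R / n := by
    intro m
    -- A majorant of the loss free of `fit` and `sel`. These depend on `ω` and need not be given as
    -- jointly measurable functions of design and lifetimes, so the kernel formula is applied to `f`
    -- instead.
    set f : (Fin n → ℝ × ℝ) × (Fin n → ℝ) → ℝ := fun q =>
      C * (bias M₁ M₂ κ m q.1 + penalty M₁ M₂ θ n m) + K / n * supExcess M₁ M₂ κ a θ m q.1 q.2
      with hf
    have hfm : Measurable f :=
      ((((measurable_bias m).comp measurable_fst).add_const _).const_mul C).add
        ((measurable_supExcess m).const_mul _)
    have hfi : Integrable (fun ω => f (fun i => (X i ω, T i ω), fun i => Y i ω)) μ := by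
      refine Integrable.of_mem_Icc (C * (0 + penalty M₁ M₂ θ n m) + K / n * 0)
        (C * (1 + penalty M₁ M₂ θ n m) + K / n * (a * n))
        (hfm.comp (hD.prodMk hY)).aemeasurable (Filter.Eventually.of_forall fun ω => ?_)
      have hb := bias_mem_Icc (M₁ := M₁) (M₂ := M₂) (κ := κ) m (fun i => (X i ω, T i ω))
      have hs := supExcess_mem_Icc (M₁ := M₁) (M₂ := M₂) (κ := κ) hapos.le hθ.le m
        (fun i => (X i ω, T i ω)) (fun i => Y i ω)
      constructor
      · dsimp only [f]
        gcongr
        exacts [hb.1, hs.1]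
      · dsimp only [f]
        gcongr
        exacts [hb.2, hs.2]
    have hmono := condExp_mono (m := MeasurableSpace.comap
      (fun ω i => (X i ω, T i ω) : Ω → Fin n → ℝ × ℝ) inferInstance)
      (hsel.integrable_loss (μ := μ) (κ := κ) hD) hfi (Filter.Eventually.of_forall fun ω =>
        empSq_trunc_sub_le_of_penalized_min hn ha hθ.le (fun i => (X i ω, T i ω))
          (fun i => Y i ω) (fit ω) (sel ω) (hsel.fit_mem ω) (hsel.fit_min ω) (hsel.sel_min ω) m)
    filter_upwards [hmono, h.condExp_ae_eq hfm hfi] with ω hω1 hω2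
    refine hω1.trans (hω2.trans_le ?_)
    have hsi : Integrable (fun y => supExcess M₁ M₂ κ a θ m (fun i => (X i ω, T i ω)) y)
        (Measure.pi fun i => κ (X i ω)) :=
      Integrable.of_mem_Icc 0 (a * n)
        ((measurable_supExcess m).comp measurable_prodMk_left).aemeasurable
        (Filter.Eventually.of_forall fun y => supExcess_mem_Icc hapos.le hθ.le m _ y)
    have hle := integral_supExcess_le (κ := κ) hn h₁ h₂ hapos haθ hc m (fun i => (X i ω, T i ω))
    simp only [hf]
    rw [integral_add (integrable_const _) (hsi.const_mul _), integral_const, probReal_univ, one_smul,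
      integral_const_mul]
    have h3 : K * R / n = K / n * R := by ring
    rw [h3]
    gcongr
  -- Countably many models share one null set, so the infimum over `m` may be taken pointwise.
  filter_upwards [ae_all_iff.2 key] with ω hω
  have : Nonempty (M₁.ι n × M₂.ι n) := ⟨sel ω⟩
  rw [oracleBound, ← sub_le_iff_le_add, ← div_le_iff₀' hC0]
  refine le_ciInf fun m => ?_
  rw [div_le_iff₀' hC0, sub_le_iff_le_add]
  refine (hω m).trans ?_
  gcongr
  exact le_ciInf fun s => bias_le_empSq m _ s.2

end Oracle

end CurrentStatus

theorem theorem1 (θ : ℝ) (hθ : 1 < θ) :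
    ∃ C₁ : ℝ, 0 < C₁ ∧ ∀ B₁ B₂ : ℝ → ℝ, ∃ C₂ : ℝ, 0 < C₂ ∧
      ∀ (a₁ b₁ a₂ b₂ : ℝ) (M₁ : ModelCollection.{u} a₁ b₁) (M₂ : ModelCollection.{u} a₂ b₂),
        M₁.HypH B₁ → M₂.HypH B₂ →
      ∀ (n : ℕ), 1 ≤ n →
      ∀ (κ : Kernel ℝ ℝ) [IsMarkovKernel κ],
      ∀ (Ω : Type v) [MeasurableSpace Ω] (μ : Measure Ω) [IsProbabilityMeasure μ],
        -- random design: conditional risk, almost surely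
        (∀ (X Y T : Fin n → Ω → ℝ), (IsIIDSample μ κ X Y T ∨ IsSampleOfDesign μ κ X Y T) →
          ∀ (fit : Ω → M₁.ι n × M₂.ι n → ℝ × ℝ → ℝ) (sel : Ω → M₁.ι n × M₂.ι n),
            IsModelSelection M₁ M₂ θ (fun ω i => (X i ω, T i ω))
              (fun ω i => status (Y i ω) (T i ω)) fit sel →
            Integrable (fun ω => empSq (fun i => (X i ω, T i ω))
              (trunc (fit ω (sel ω)) - condCdf κ)) μ ∧
            μ[fun ω => empSq (fun i => (X i ω, T i ω)) (trunc (fit ω (sel ω)) - condCdf κ) |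
                MeasurableSpace.comap (fun ω i => (X i ω, T i ω)) inferInstance]
              ≤ᵐ[μ] fun ω => oracleBound M₁ M₂ κ θ C₁ C₂ (fun i => (X i ω, T i ω))) ∧
        -- fixed design: every deterministic design
        (∀ (x t : Fin n → ℝ) (Y : Fin n → Ω → ℝ), (∀ i, Measurable (Y i)) → iIndepFun Y μ →
          (∀ i, μ.map (Y i) = κ (x i)) →
          ∀ (fit : Ω → M₁.ι n × M₂.ι n → ℝ × ℝ → ℝ) (sel : Ω → M₁.ι n × M₂.ι n),
            IsModelSelection M₁ M₂ θ (fun _ i => (x i, t i))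
              (fun ω i => status (Y i ω) (t i)) fit sel →
            Integrable (fun ω => empSq (fun i => (x i, t i))
              (trunc (fit ω (sel ω)) - condCdf κ)) μ ∧
            ∫ ω, empSq (fun i => (x i, t i)) (trunc (fit ω (sel ω)) - condCdf κ) ∂μ
              ≤ oracleBound M₁ M₂ κ θ C₁ C₂ (fun i => (x i, t i))) := by
  -- Any function of `θ` with values in `(1, θ)` would do; all constants then depend on `θ` and the
  -- bounds in (H) only.
  set a : ℝ := (1 + θ) / 2 with ha
  have ha1 : 1 < a := by linarith
  have haθ : a < θ := by linarith
  have ha0 : 0 < a - 1 := by linarith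
  have hd : 0 < θ - a := by linarith
  have hapos : 0 < a := by linarith
  have hθ0 : 0 < θ := by linarith
  refine ⟨2 * a / (a - 1) * (2 + (a + 1) / (a * (a - 1))), by positivity, fun B₁ B₂ => ?_⟩
  set c : ℝ := (θ - a) ^ 2 / (4 * a * (θ + a)) with hc
  refine ⟨2 * a / (a - 1) *
    (a * θ / (θ - a) * (1 + max 0 (B₁ (c / 2)) * max 0 (B₂ (c / 2)))), by positivity, ?_⟩
  intro a₁ b₁ a₂ b₂ M₁ M₂ h₁ h₂ n hn κ _ Ω _ μ _
  have := h₁.countable hn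
  have := h₂.countable hn
  constructor
  · intro X Y T hsample fit sel hsel
    have h : IsSampleOfDesign μ κ X Y T := hsample.elim (fun h => h.isSampleOfDesign) id
    exact ⟨hsel.integrable_loss (measurable_pi_lambda _ fun i =>
      (h.measurable_X i).prodMk (h.measurable_T i)),
      h.condExp_loss_le hn h₁ h₂ ha1 haθ hc hsel⟩
  · intro x t Y hY hindep hlaw fit sel hsel
    refine ⟨hsel.integrable_loss measurable_const, ?_⟩
    have h := (isSampleOfDesign_const (t := t) hY hindep hlaw).condExp_loss_le hn h₁ h₂ ha1 haθ hc
      hsel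
    -- A constant design generates the trivial σ-algebra, so both sides are constant in `ω` and the
    -- almost sure inequality holds outright.
    rw [MeasurableSpace.comap_const, condExp_bot] at h
    exact h.exists.choose_spec
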